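/- **Theorem (Berestovskii).** Let $\kappa\in\mathbb R$ and let $Y$ be a metric space. The $\kappa$-cone $C_\kappa Y$ is a CAT($\kappa$) space if and only if $Y$ is a CAT(1) space. Here $D_\kappa=\pi/\sqrt\kappa$ if $\kappa>0$ and $D_\kappa=\infty$ if $\kappa\le 0$. Let $M_\kappa^2$ be the Euclidean plane if $\kappa=0$, the unit sphere $\mathbb S^2$ with its angular distance multiplied by $1/\sqrt{\kappa}$ if $\kappa>0$, and the hyperbolic plane $\mathbb H^2$ with its distance multiplied by $1/\sqrt{-\kappa}$ if $\kappa<0$. *CAT($\kappa$) spaces.* A metric space $X$ is CAT($\kappa$) if any two points $x,y\in X$ with $d(x,y)<D_\kappa$ are joined by a geodesic, and if every geodesic triangle $\Delta=[p,q]\cup[q,r]\cup[r,p]$ in $X$ of perimeter less than $2D_\kappa$ satisfies $d(x,y)\le d_{M_\kappa^2}(\bar x,\bar y)$ for all $x,y\in\Delta$ and all comparison points $\bar x,\bar y$ of them in a comparison triangle $\bar\Delta\subset M_\kappa^2$ (a geodesic triangle with the same side lengths as $\Delta$; a comparison point of a point on a side of $\Delta$ is the point of the corresponding side of $\bar\Delta$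 at the same distances from the endpoints of that side). *The $\kappa$-cone.* As a set, $C_\kappa Y$ is the quotient of $[0,\infty)\times Y$ if $\kappa\le 0$, and of $[0,D_\kappa/2]\times Y$ if $\kappa>0$, obtained by identifying all points $(0,y)$ with each other. Put $\theta=\min\{\pi,d(y,y')\}$. The distance $d$ between the classes of $(t,y)$ and $(t',y')$ is the unique number $d\ge 0$ (with $d\le D_\kappa$ if $\kappa>0$) such that $$d^2=t^2+t'^2-2tt'\cos\theta\qquad(\kappa=0),$$ $$\cosh(\sqrt{-\kappa}\,d)=\cosh(\sqrt{-\kappa}\,t)\cosh(\sqrt{-\kappa}\,t')-\sinh(\sqrt{-\kappa}\,t)\sinh(\sqrt{-\kappa}\,t')\cos\theta\qquad(\kappa<0),$$ $$\cos(\sqrt{\kappa}\,d)=\cos(\sqrt{\kappa}\,t)\cos(\sqrt{\kappa}\,t')+\sin(\sqrt{\kappa}\,t)\sin(\sqrt{\kappa}\,t')\cos\theta\qquad(\kappa>0).$$ -/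

import Mathlib

universe u

section CatSpaces

/-! ### Geodesics and geodesic triangles in a metric space -/

/-- `c`, restricted to `[0, l]`, is a geodesic of length `l` joining `x` to `y`. -/
def IsGeodesic {X : Type u} [MetricSpace X] (c : ℝ → X) (l : ℝ) (x y : X) : Prop :=
  0 ≤ l ∧ c 0 = x ∧ c l = y ∧
    ∀ t ∈ Set.Icc (0 : ℝ) l, ∀ t' ∈ Set.Icc (0 : ℝ) l, dist (c t) (c t') = |t - t'|

/-- `S` is a geodesic segment joining `x` to `y`: the image of a geodesic from `x` to `y`. -/
def IsGeodesicSegment {X : Type u} [MetricSpace X] (S : Set X) (x y : X) : Prop :=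
  ∃ (c : ℝ → X) (l : ℝ), IsGeodesic c l x y ∧ S = c '' Set.Icc (0 : ℝ) l

/-- A geodesic triangle: three vertices and a choice of geodesic segments joining them. -/
structure GeodesicTriangle (X : Type u) [MetricSpace X] where
  (p q r : X)
  (pq qr rp : Set X)
  (isSegment_pq : IsGeodesicSegment pq p q)
  (isSegment_qr : IsGeodesicSegment qr q r)
  (isSegment_rp : IsGeodesicSegment rp r p)

/-- The perimeter of a geodesic triangle. -/
noncomputable def GeodesicTriangle.perimeter {X : Type u} [MetricSpace X]
    (T : GeodesicTriangle X) : ℝ :=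
  dist T.p T.q + dist T.q T.r + dist T.r T.p

/-! ### The model planes -/

open Real

/-- The underlying set of the model plane of curvature `κ`, inside `ℝ³`: the Euclidean plane
(realised as `z = 0`) for `κ = 0`, the unit sphere for `κ > 0`, and the upper sheet of the
hyperboloid for `κ < 0`. -/
def modelCarrier (κ : ℝ) : Set (EuclideanSpace ℝ (Fin 3)) :=
  {v | (κ = 0 → v 2 = 0) ∧
    (0 < κ → v 0 ^ 2 + v 1 ^ 2 + v 2 ^ 2 = 1) ∧
    (κ < 0 → v 0 ^ 2 + v 1 ^ 2 - v 2 ^ 2 = -1 ∧ 0 < v 2)}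

/-- The distance of the model plane of curvature `κ`: Euclidean for `κ = 0`, the angular distance
of the sphere divided by `√κ` for `κ > 0`, the hyperbolic distance divided by `√(-κ)` for
`κ < 0`. -/
noncomputable def modelDist (κ : ℝ) (v w : EuclideanSpace ℝ (Fin 3)) : ℝ :=
  if κ = 0 then dist v w
  else if 0 < κ then arccos (v 0 * w 0 + v 1 * w 1 + v 2 * w 2) / √κ
  else arcosh (v 2 * w 2 - v 0 * w 0 - v 1 * w 1) / √(-κ)

/-- The model plane of constant curvature `κ`. -/
def ModelPlane (κ : ℝ) : Type := {v : EuclideanSpace ℝ (Fin 3) // v ∈ modelCarrier κ}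

theorem gram_sphere {u0 u1 u2 v0 v1 v2 w0 w1 w2 : ℝ}
    (hu : u0 ^ 2 + u1 ^ 2 + u2 ^ 2 = 1) (hv : v0 ^ 2 + v1 ^ 2 + v2 ^ 2 = 1)
    (hw : w0 ^ 2 + w1 ^ 2 + w2 ^ 2 = 1) :
    ((u0 * v0 + u1 * v1 + u2 * v2) * (v0 * w0 + v1 * w1 + v2 * w2)
        - (u0 * w0 + u1 * w1 + u2 * w2)) ^ 2
      ≤ (1 - (u0 * v0 + u1 * v1 + u2 * v2) ^ 2) * (1 - (v0 * w0 + v1 * w1 + v2 * w2) ^ 2) := by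
  have key : (u0 ^ 2 + u1 ^ 2 + u2 ^ 2) * (v0 ^ 2 + v1 ^ 2 + v2 ^ 2) * (w0 ^ 2 + w1 ^ 2 + w2 ^ 2)
      + 2 * (u0 * v0 + u1 * v1 + u2 * v2) * (v0 * w0 + v1 * w1 + v2 * w2)
          * (u0 * w0 + u1 * w1 + u2 * w2)
      - (u0 * v0 + u1 * v1 + u2 * v2) ^ 2 * (w0 ^ 2 + w1 ^ 2 + w2 ^ 2)
      - (v0 * w0 + v1 * w1 + v2 * w2) ^ 2 * (u0 ^ 2 + u1 ^ 2 + u2 ^ 2)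
      - (u0 * w0 + u1 * w1 + u2 * w2) ^ 2 * (v0 ^ 2 + v1 ^ 2 + v2 ^ 2)
      = (u0 * (v1 * w2 - v2 * w1) - u1 * (v0 * w2 - v2 * w0) + u2 * (v0 * w1 - v1 * w0)) ^ 2 := by
    ring
  rw [hu, hv, hw] at key
  nlinarith [sq_nonneg (u0 * (v1 * w2 - v2 * w1) - u1 * (v0 * w2 - v2 * w0)
    + u2 * (v0 * w1 - v1 * w0))]

theorem gram_hyperboloid {u0 u1 u2 v0 v1 v2 w0 w1 w2 : ℝ}
    (hu : u0 ^ 2 + u1 ^ 2 - u2 ^ 2 = -1) (hv : v0 ^ 2 + v1 ^ 2 - v2 ^ 2 = -1)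
    (hw : w0 ^ 2 + w1 ^ 2 - w2 ^ 2 = -1) :
    ((u2 * v2 - u0 * v0 - u1 * v1) * (v2 * w2 - v0 * w0 - v1 * w1)
        - (u2 * w2 - u0 * w0 - u1 * w1)) ^ 2
      ≤ ((u2 * v2 - u0 * v0 - u1 * v1) ^ 2 - 1) * ((v2 * w2 - v0 * w0 - v1 * w1) ^ 2 - 1) := by
  have key : -((u0 ^ 2 + u1 ^ 2 - u2 ^ 2) * (v0 ^ 2 + v1 ^ 2 - v2 ^ 2)
        * (w0 ^ 2 + w1 ^ 2 - w2 ^ 2))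
      + 2 * (u2 * v2 - u0 * v0 - u1 * v1) * (v2 * w2 - v0 * w0 - v1 * w1)
          * (u2 * w2 - u0 * w0 - u1 * w1)
      + (u2 * v2 - u0 * v0 - u1 * v1) ^ 2 * (w0 ^ 2 + w1 ^ 2 - w2 ^ 2)
      + (v2 * w2 - v0 * w0 - v1 * w1) ^ 2 * (u0 ^ 2 + u1 ^ 2 - u2 ^ 2)
      + (u2 * w2 - u0 * w0 - u1 * w1) ^ 2 * (v0 ^ 2 + v1 ^ 2 - v2 ^ 2)
      = (u0 * (v1 * w2 - v2 * w1) - u1 * (v0 * w2 - v2 * w0) + u2 * (v0 * w1 - v1 * w0)) ^ 2 := by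
    ring
  rw [hu, hv, hw] at key
  nlinarith [sq_nonneg (u0 * (v1 * w2 - v2 * w1) - u1 * (v0 * w2 - v2 * w0)
    + u2 * (v0 * w1 - v1 * w0))]

theorem hyperboloid_sq_sub {u0 u1 u2 v0 v1 v2 : ℝ}
    (hu : u0 ^ 2 + u1 ^ 2 - u2 ^ 2 = -1) (hv : v0 ^ 2 + v1 ^ 2 - v2 ^ 2 = -1) :
    (u2 * v2) ^ 2 - (1 + (u0 * v0 + u1 * v1)) ^ 2
      = (u0 - v0) ^ 2 + (u1 - v1) ^ 2 + (u0 * v1 - u1 * v0) ^ 2 := by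
  have h1 : u2 ^ 2 = 1 + u0 ^ 2 + u1 ^ 2 := by linarith
  have h2 : v2 ^ 2 = 1 + v0 ^ 2 + v1 ^ 2 := by linarith
  rw [mul_pow, h1, h2]; ring

theorem one_le_hyperboloid {u0 u1 u2 v0 v1 v2 : ℝ}
    (hu : u0 ^ 2 + u1 ^ 2 - u2 ^ 2 = -1) (hu2 : 0 < u2)
    (hv : v0 ^ 2 + v1 ^ 2 - v2 ^ 2 = -1) (hv2 : 0 < v2) :
    1 ≤ u2 * v2 - u0 * v0 - u1 * v1 := by
  have h := hyperboloid_sq_sub hu hv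
  have : 1 + (u0 * v0 + u1 * v1) ≤ u2 * v2 := by
    apply le_of_sq_le_sq _ (by positivity)
    nlinarith [sq_nonneg (u0 - v0), sq_nonneg (u1 - v1), sq_nonneg (u0 * v1 - u1 * v0)]
  linarith

theorem sphere_abs_le {u0 u1 u2 v0 v1 v2 : ℝ}
    (hu : u0 ^ 2 + u1 ^ 2 + u2 ^ 2 = 1) (hv : v0 ^ 2 + v1 ^ 2 + v2 ^ 2 = 1) :
    -1 ≤ u0 * v0 + u1 * v1 + u2 * v2 ∧ u0 * v0 + u1 * v1 + u2 * v2 ≤ 1 := by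
  constructor
  · nlinarith [sq_nonneg (u0 + v0), sq_nonneg (u1 + v1), sq_nonneg (u2 + v2)]
  · nlinarith [sq_nonneg (u0 - v0), sq_nonneg (u1 - v1), sq_nonneg (u2 - v2)]

theorem arccos_le_add {A B C : ℝ} (hA : -1 ≤ A ∧ A ≤ 1) (hB : -1 ≤ B ∧ B ≤ 1)
    (h : (A * B - C) ^ 2 ≤ (1 - A ^ 2) * (1 - B ^ 2)) :
    arccos C ≤ arccos A + arccos B := by
  by_cases hpi : arccos A + arccos B ≤ π
  · have h1 : cos (arccos A + arccos B) ≤ C := by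
      rw [cos_add, cos_arccos hA.1 hA.2, cos_arccos hB.1 hB.2, sin_arccos, sin_arccos,
        ← sqrt_mul (by nlinarith [hA.1, hA.2])]
      have := Real.abs_le_sqrt h
      linarith [(abs_le.1 this).2]
    calc arccos C ≤ arccos (cos (arccos A + arccos B)) := arccos_le_arccos h1
      _ = _ := arccos_cos (add_nonneg (arccos_nonneg _) (arccos_nonneg _)) hpi
  · exact (arccos_le_pi _).trans (not_le.1 hpi).le

theorem arcosh_le_add {A B C : ℝ} (hA : 1 ≤ A) (hB : 1 ≤ B) (hC : 1 ≤ C)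
    (h : (A * B - C) ^ 2 ≤ (A ^ 2 - 1) * (B ^ 2 - 1)) :
    arcosh C ≤ arcosh A + arcosh B := by
  have h0 : 0 ≤ arcosh A + arcosh B := add_nonneg (arcosh_nonneg hA) (arcosh_nonneg hB)
  rw [← arcosh_cosh h0, arcosh_le_arcosh (by linarith) (cosh_pos _), cosh_add, cosh_arcosh hA,
    cosh_arcosh hB, sinh_arcosh hA, sinh_arcosh hB, ← sqrt_mul (by nlinarith)]
  linarith [(abs_le.1 (Real.abs_le_sqrt h)).1]

theorem modelDist_triangle {κ : ℝ} {u v w : EuclideanSpace ℝ (Fin 3)} (hu : u ∈ modelCarrier κ)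
    (hv : v ∈ modelCarrier κ) (hw : w ∈ modelCarrier κ) :
    modelDist κ u w ≤ modelDist κ u v + modelDist κ v w := by
  obtain ⟨-, hu1, hu2⟩ := hu
  obtain ⟨-, hv1, hv2⟩ := hv
  obtain ⟨-, hw1, hw2⟩ := hw
  unfold modelDist
  split_ifs with h0 h1
  · exact dist_triangle _ _ _
  · rw [← add_div]
    exact div_le_div_of_nonneg_right (arccos_le_add (sphere_abs_le (hu1 h1) (hv1 h1))
      (sphere_abs_le (hv1 h1) (hw1 h1))
      (gram_sphere (hu1 h1) (hv1 h1) (hw1 h1))) (sqrt_nonneg _)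
  · have h2 : κ < 0 := lt_of_le_of_ne (not_lt.1 h1) h0
    obtain ⟨a, a'⟩ := hu2 h2
    obtain ⟨b, b'⟩ := hv2 h2
    obtain ⟨c, c'⟩ := hw2 h2
    rw [← add_div]
    exact div_le_div_of_nonneg_right (arcosh_le_add (one_le_hyperboloid a a' b b')
      (one_le_hyperboloid b b' c c') (one_le_hyperboloid a a' c c')
      (gram_hyperboloid a b c)) (sqrt_nonneg _)

noncomputable instance ModelPlane.instMetricSpace (κ : ℝ) : MetricSpace (ModelPlane κ) where
  dist v w := modelDist κ v.1 w.1
  dist_self v := by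
    obtain ⟨v, -, h1, h2⟩ := v
    simp only [modelDist]
    split_ifs with h h'
    · simp
    · have := h1 h'
      rw [show v 0 * v 0 + v 1 * v 1 + v 2 * v 2 = 1 by linarith]; simp
    · have := (h2 (lt_of_le_of_ne (not_lt.1 h') h)).1
      rw [show v 2 * v 2 - v 0 * v 0 - v 1 * v 1 = 1 by linarith]; simp
  dist_comm v w := by
    simp only [modelDist, dist_comm v.1 w.1, mul_comm (v.1 _)]
  dist_triangle u v w := modelDist_triangle u.2 v.2 w.2
  eq_of_dist_eq_zero := by
    rintro ⟨v, hv0, hv1, hv2⟩ ⟨w, hw0, hw1, hw2⟩ hd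
    apply Subtype.ext
    simp only [modelDist] at hd ⊢
    split_ifs at hd with h h'
    · exact dist_eq_zero.1 hd
    · have hs : √κ ≠ 0 := (sqrt_pos.2 h').ne'
      have h3 : 1 ≤ v 0 * w 0 + v 1 * w 1 + v 2 * w 2 := by
        simpa [hs] using hd
      have a := hv1 h'
      have b := hw1 h'
      have e0 : (v 0 - w 0) = 0 := pow_eq_zero_iff (two_ne_zero) |>.1
        (le_antisymm (by nlinarith [sq_nonneg (v 1 - w 1), sq_nonneg (v 2 - w 2)]) (sq_nonneg _))
      have e1 : (v 1 - w 1) = 0 := pow_eq_zero_iff (two_ne_zero) |>.1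
        (le_antisymm (by nlinarith [sq_nonneg (v 0 - w 0), sq_nonneg (v 2 - w 2)]) (sq_nonneg _))
      have e2 : (v 2 - w 2) = 0 := pow_eq_zero_iff (two_ne_zero) |>.1
        (le_antisymm (by nlinarith [sq_nonneg (v 1 - w 1), sq_nonneg (v 0 - w 0)]) (sq_nonneg _))
      ext i; fin_cases i
      · exact sub_eq_zero.1 e0
      · exact sub_eq_zero.1 e1
      · exact sub_eq_zero.1 e2
    · have hneg : κ < 0 := lt_of_le_of_ne (not_lt.1 h') h
      have hs : √(-κ) ≠ 0 := (sqrt_pos.2 (by linarith)).ne'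
      obtain ⟨a, a'⟩ := hv2 hneg
      obtain ⟨b, b'⟩ := hw2 hneg
      have h3 : v 2 * w 2 - v 0 * w 0 - v 1 * w 1 = 1 :=
        (arcosh_eq_zero_iff (one_le_hyperboloid a a' b b')).1 (by simpa [hs] using hd)
      have h4 := hyperboloid_sq_sub a b
      rw [show v 2 * w 2 = 1 + (v 0 * w 0 + v 1 * w 1) by linarith, sub_self] at h4
      have e0 : (v 0 - w 0) = 0 := pow_eq_zero_iff (two_ne_zero) |>.1
        (le_antisymm (by nlinarith [sq_nonneg (v 1 - w 1), sq_nonneg (v 0 * w 1 - v 1 * w 0)])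
          (sq_nonneg _))
      have e1 : (v 1 - w 1) = 0 := pow_eq_zero_iff (two_ne_zero) |>.1
        (le_antisymm (by nlinarith [sq_nonneg (v 0 - w 0), sq_nonneg (v 0 * w 1 - v 1 * w 0)])
          (sq_nonneg _))
      have e2 : v 2 = w 2 := by
        rw [sub_eq_zero.1 e0, sub_eq_zero.1 e1] at a
        exact (sq_eq_sq₀ a'.le b'.le).1 (by linarith)
      ext i; fin_cases i
      · exact sub_eq_zero.1 e0
      · exact sub_eq_zero.1 e1
      · exact e2

/-! ### Comparison triangles and CAT(κ) spaces -/

/-- `T'` is a comparison triangle for `T` in the model plane of curvature `κ`. -/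
def IsComparisonTriangle {X : Type u} [MetricSpace X] {κ : ℝ}
    (T : GeodesicTriangle X) (T' : GeodesicTriangle (ModelPlane κ)) : Prop :=
  dist T.p T.q = dist T'.p T'.q ∧ dist T.q T.r = dist T'.q T'.r ∧ dist T.r T.p = dist T'.r T'.p

/-- `x'` is a comparison point for `x`: `x` lies on a side of `T`, `x'` lies on the corresponding
side of `T'`, and they have the same distances to the respective endpoints of that side. -/
def IsComparisonPoint {X : Type u} [MetricSpace X] {κ : ℝ}
    (T : GeodesicTriangle X) (T' : GeodesicTriangle (ModelPlane κ)) (x : X)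
    (x' : ModelPlane κ) : Prop :=
  (x ∈ T.pq ∧ x' ∈ T'.pq ∧ dist x T.p = dist x' T'.p ∧ dist x T.q = dist x' T'.q) ∨
  (x ∈ T.qr ∧ x' ∈ T'.qr ∧ dist x T.q = dist x' T'.q ∧ dist x T.r = dist x' T'.r) ∨
  (x ∈ T.rp ∧ x' ∈ T'.rp ∧ dist x T.r = dist x' T'.r ∧ dist x T.p = dist x' T'.p)

/-- The CAT(κ) inequality for a geodesic triangle. -/
def SatisfiesCATInequality {X : Type u} [MetricSpace X] (κ : ℝ) (T : GeodesicTriangle X) : Prop :=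
  ∀ T' : GeodesicTriangle (ModelPlane κ), IsComparisonTriangle T T' →
    ∀ (x y : X) (x' y' : ModelPlane κ),
      IsComparisonPoint T T' x x' → IsComparisonPoint T T' y y' → dist x y ≤ dist x' y'

/-- A CAT(κ) space. With `D = π / √κ` if `κ > 0` and `D = ∞` otherwise: any two points at distance
less than `D` are joined by a geodesic, and every geodesic triangle of perimeter less than `2 D`
satisfies the CAT(κ) inequality. -/
def IsCAT (κ : ℝ) (X : Type u) [MetricSpace X] : Prop :=
  (∀ x y : X, (0 < κ → dist x y < π / √κ) → ∃ (c : ℝ → X) (l : ℝ), IsGeodesic c l x y) ∧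
  ∀ T : GeodesicTriangle X, (0 < κ → T.perimeter < 2 * (π / √κ)) → SatisfiesCATInequality κ T

/-! ### The κ-cone -/

/-- Admissible radii: `[0, ∞)` if `κ ≤ 0`, and `[0, D / 2]` with `D = π / √κ` if `κ > 0`. -/
def coneRadii (κ : ℝ) : Set ℝ := {t | 0 ≤ t ∧ (0 < κ → t ≤ π / √κ / 2)}

/-- Two points of `coneRadii κ × Y` are identified if they are equal or both have radius `0`. -/
def coneSetoid (κ : ℝ) (Y : Type u) : Setoid (coneRadii κ × Y) where
  r a b := a = b ∨ ((a.1 : ℝ) = 0 ∧ (b.1 : ℝ) = 0)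
  iseqv := by
    refine ⟨fun _ => Or.inl rfl, ?_, ?_⟩
    · rintro a b (h | h)
      · exact Or.inl h.symm
      · exact Or.inr h.symm
    · rintro a b c (rfl | h) (rfl | h')
      · exact Or.inl rfl
      · exact Or.inr h'
      · exact Or.inr h
      · exact Or.inr ⟨h.1, h'.2⟩

/-- The κ-cone over `Y`. -/
def KCone (κ : ℝ) (Y : Type u) : Type u := Quotient (coneSetoid κ Y)

/-- The length of the third side in the law of cosines of curvature `κ`, for two sides of lengths
`t`, `t'` that enclose the angle `θ`. -/
noncomputable def coneLaw (κ t t' θ : ℝ) : ℝ :=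
  if κ = 0 then √(t ^ 2 + t' ^ 2 - 2 * t * t' * cos θ)
  else if 0 < κ then
    arccos (cos (√κ * t) * cos (√κ * t') + sin (√κ * t) * sin (√κ * t') * cos θ) / √κ
  else
    arcosh (cosh (√(-κ) * t) * cosh (√(-κ) * t') - sinh (√(-κ) * t) * sinh (√(-κ) * t') * cos θ)
      / √(-κ)

/-- The point of the model plane with polar coordinates `(t, θ)`. -/
noncomputable def modelPolar (κ t θ : ℝ) : EuclideanSpace ℝ (Fin 3) :=
  if κ = 0 then !₂[t * cos θ, t * sin θ, 0]
  else if 0 < κ then !₂[sin (√κ * t) * cos θ, sin (√κ * t) * sin θ, cos (√κ * t)]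
  else !₂[sinh (√(-κ) * t) * cos θ, sinh (√(-κ) * t) * sin θ, cosh (√(-κ) * t)]

theorem modelPolar_mem (κ t θ : ℝ) : modelPolar κ t θ ∈ modelCarrier κ := by
  refine ⟨fun h => ?_, fun h => ?_, fun h => ?_⟩
  · simp [modelPolar, h]
  · simp only [modelPolar, h, h.ne', if_true, if_false]
    simp
    nlinarith [sin_sq_add_cos_sq θ, sin_sq_add_cos_sq (√κ * t)]
  · simp only [modelPolar, not_lt.2 h.le, h.ne, if_false]
    simp
    refine ⟨?_, cosh_pos _⟩
    rw [cosh_sq (√(-κ) * t)]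
    linear_combination (sinh (√(-κ) * t)) ^ 2 * sin_sq_add_cos_sq θ

theorem modelDist_modelPolar (κ t t' θ θ' : ℝ) :
    modelDist κ (modelPolar κ t θ) (modelPolar κ t' θ') = coneLaw κ t t' (θ - θ') := by
  unfold modelDist modelPolar coneLaw
  rw [cos_sub]
  split_ifs with h h'
  · rw [EuclideanSpace.dist_eq]
    simp only [Fin.sum_univ_three, Real.dist_eq, sq_abs]
    simp
    congr 1
    linear_combination t ^ 2 * sin_sq_add_cos_sq θ + t' ^ 2 * sin_sq_add_cos_sq θ'
  · simp
    congr 2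
    ring
  · simp
    congr 2
    ring

theorem sin_sqrt_mul_nonneg {κ t : ℝ} (hκ : 0 < κ) (ht : t ∈ coneRadii κ) :
    0 ≤ √κ * t ∧ √κ * t ≤ π / 2 := by
  have hs : 0 < √κ := sqrt_pos.2 hκ
  refine ⟨mul_nonneg hs.le ht.1, ?_⟩
  have := mul_le_mul_of_nonneg_left (ht.2 hκ) hs.le
  rwa [show √κ * (π / √κ / 2) = π / 2 by field_simp] at this

theorem one_le_hyperbolicLaw {a b : ℝ} (ha : 0 ≤ a) (hb : 0 ≤ b) (θ : ℝ) :
    1 ≤ cosh a * cosh b - sinh a * sinh b * cos θ := by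
  have h1 := one_le_cosh (a - b)
  rw [cosh_sub] at h1
  have := mul_nonneg (mul_nonneg (sinh_nonneg_iff.2 ha) (sinh_nonneg_iff.2 hb))
    (sub_nonneg.2 (cos_le_one θ))
  linarith

theorem coneLaw_mono {κ t t' θ θ' : ℝ} (ht : t ∈ coneRadii κ) (ht' : t' ∈ coneRadii κ)
    (h : cos θ' ≤ cos θ) : coneLaw κ t t' θ ≤ coneLaw κ t t' θ' := by
  unfold coneLaw
  split_ifs with h0 h1
  · apply sqrt_le_sqrt
    have := mul_le_mul_of_nonneg_left h (mul_nonneg ht.1 ht'.1)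
    linarith
  · refine div_le_div_of_nonneg_right (arccos_le_arccos ?_) (sqrt_nonneg _)
    obtain ⟨a, b⟩ := sin_sqrt_mul_nonneg h1 ht
    obtain ⟨a', b'⟩ := sin_sqrt_mul_nonneg h1 ht'
    have := mul_le_mul_of_nonneg_left h (mul_nonneg
      (sin_nonneg_of_nonneg_of_le_pi a (by linarith [pi_pos]))
      (sin_nonneg_of_nonneg_of_le_pi a' (by linarith [pi_pos])))
    linarith
  · refine div_le_div_of_nonneg_right ?_ (sqrt_nonneg _)
    have a : 0 ≤ √(-κ) * t := mul_nonneg (sqrt_nonneg _) ht.1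
    have a' : 0 ≤ √(-κ) * t' := mul_nonneg (sqrt_nonneg _) ht'.1
    rw [arcosh_le_arcosh (by linarith [one_le_hyperbolicLaw a a' θ])
      (by linarith [one_le_hyperbolicLaw a a' θ'])]
    have := mul_le_mul_of_nonneg_left h (mul_nonneg (sinh_nonneg_iff.2 a) (sinh_nonneg_iff.2 a'))
    linarith

theorem coneLaw_triangle {κ t₁ t₂ t₃ α β γ : ℝ} (h₁ : t₁ ∈ coneRadii κ) (h₂ : t₂ ∈ coneRadii κ)
    (h₃ : t₃ ∈ coneRadii κ) (hα0 : 0 ≤ α) (hα : α ≤ π) (hβ : β ≤ π) (hγ0 : 0 ≤ γ)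
    (hγ : γ ≤ π) (h : γ ≤ α + β) : coneLaw κ t₁ t₃ γ ≤ coneLaw κ t₁ t₂ α + coneLaw κ t₂ t₃ β := by
  obtain ⟨α', h0, h1, h2, h3⟩ : ∃ α', 0 ≤ α' ∧ α' ≤ α ∧ γ ≤ α' + β ∧ α' + β ≤ π := by
    by_cases hab : α + β ≤ π
    · exact ⟨α, hα0, le_rfl, h, hab⟩
    · exact ⟨π - β, by linarith, by linarith, by linarith, by linarith⟩
  have e := modelDist_triangle (modelPolar_mem κ t₁ (α' + β)) (modelPolar_mem κ t₂ β)
    (modelPolar_mem κ t₃ 0)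
  simp only [modelDist_modelPolar, sub_zero, add_sub_cancel_right] at e
  calc coneLaw κ t₁ t₃ γ ≤ coneLaw κ t₁ t₃ (α' + β) :=
        coneLaw_mono h₁ h₃ (cos_le_cos_of_nonneg_of_le_pi hγ0 h3 h2)
    _ ≤ coneLaw κ t₁ t₂ α' + coneLaw κ t₂ t₃ β := e
    _ ≤ _ := by
      gcongr
      exact coneLaw_mono h₁ h₂ (cos_le_cos_of_nonneg_of_le_pi h0 hα h1)

theorem coneLaw_comm (κ t t' θ : ℝ) : coneLaw κ t t' θ = coneLaw κ t' t θ := by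
  unfold coneLaw
  rw [show t ^ 2 + t' ^ 2 - 2 * t * t' * cos θ = t' ^ 2 + t ^ 2 - 2 * t' * t * cos θ by ring,
    mul_comm (cos (√κ * t)), mul_comm (sin (√κ * t)), mul_comm (cosh (√(-κ) * t)),
    mul_comm (sinh (√(-κ) * t))]

theorem coneLaw_self {κ t : ℝ} : coneLaw κ t t 0 = 0 := by
  unfold coneLaw
  split_ifs
  · rw [cos_zero, show t ^ 2 + t ^ 2 - 2 * t * t * 1 = 0 by ring, sqrt_zero]
  · rw [cos_zero, mul_one, ← sq, ← sq, cos_sq_add_sin_sq, arccos_one, zero_div]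
  · rw [cos_zero, mul_one, ← sq, ← sq, cosh_sq_sub_sinh_sq]; simp

theorem coneLaw_zero_left (κ t θ θ' : ℝ) : coneLaw κ 0 t θ = coneLaw κ 0 t θ' := by
  simp [coneLaw]

theorem coneLaw_eq_zero {κ t t' θ : ℝ} (ht : t ∈ coneRadii κ) (ht' : t' ∈ coneRadii κ)
    (h : coneLaw κ t t' θ = 0) : t = t' ∧ (t = 0 ∨ cos θ = 1) := by
  have hc : 0 ≤ 1 - cos θ := sub_nonneg.2 (cos_le_one θ)
  unfold coneLaw at h
  split_ifs at h with h0 h1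
  · have hp : 0 ≤ t * t' * (1 - cos θ) := mul_nonneg (mul_nonneg ht.1 ht'.1) hc
    have h2 : t ^ 2 + t' ^ 2 - 2 * t * t' * cos θ ≤ 0 := sqrt_eq_zero'.1 h
    have e : t - t' = 0 := pow_eq_zero_iff (two_ne_zero) |>.1
      (le_antisymm (by nlinarith) (sq_nonneg _))
    have e' : t = t' := sub_eq_zero.1 e
    subst e'
    refine ⟨rfl, ?_⟩
    have : t * t * (1 - cos θ) = 0 := le_antisymm (by nlinarith) hp
    rcases mul_eq_zero.1 this with h | h
    · exact Or.inl (mul_self_eq_zero.1 h)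
    · exact Or.inr (by linarith)
  · have hs : 0 < √κ := sqrt_pos.2 h1
    obtain ⟨a, b⟩ := sin_sqrt_mul_nonneg h1 ht
    obtain ⟨a', b'⟩ := sin_sqrt_mul_nonneg h1 ht'
    have hp := mul_nonneg (mul_nonneg
      (sin_nonneg_of_nonneg_of_le_pi a (by linarith [pi_pos]))
      (sin_nonneg_of_nonneg_of_le_pi a' (by linarith [pi_pos]))) hc
    have h2 : 1 ≤ cos (√κ * t) * cos (√κ * t') + sin (√κ * t) * sin (√κ * t') * cos θ := by
      simpa [hs.ne'] using h
    have h3 := cos_le_one (√κ * t - √κ * t')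
    have h4 := cos_sub (√κ * t) (√κ * t')
    have h5 : cos (√κ * t - √κ * t') = 1 := by linarith
    have h6 : √κ * t - √κ * t' = 0 :=
      (cos_eq_one_iff_of_lt_of_lt (by linarith [pi_pos]) (by linarith [pi_pos])).1 h5
    have e' : t = t' := mul_left_cancel₀ hs.ne' (sub_eq_zero.1 h6)
    subst e'
    refine ⟨rfl, ?_⟩
    have : sin (√κ * t) * sin (√κ * t) * (1 - cos θ) = 0 := le_antisymm (by linarith) hp
    rcases mul_eq_zero.1 this with h | h
    · have h7 := mul_self_eq_zero.1 h
      rw [sin_eq_zero_iff_of_lt_of_lt (by linarith [pi_pos]) (by linarith [pi_pos])] at h7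
      exact Or.inl ((mul_eq_zero.1 h7).resolve_left hs.ne')
    · exact Or.inr (by linarith)
  · have h1' : κ < 0 := lt_of_le_of_ne (not_lt.1 h1) h0
    have hs : 0 < √(-κ) := sqrt_pos.2 (by linarith)
    have a : 0 ≤ √(-κ) * t := mul_nonneg hs.le ht.1
    have a' : 0 ≤ √(-κ) * t' := mul_nonneg hs.le ht'.1
    have hp := mul_nonneg (mul_nonneg (sinh_nonneg_iff.2 a) (sinh_nonneg_iff.2 a')) hc
    have h2 := (arcosh_eq_zero_iff (one_le_hyperbolicLaw a a' θ)).1 (by simpa [hs.ne'] using h)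
    have h3 := one_le_cosh (√(-κ) * t - √(-κ) * t')
    have h4 := cosh_sub (√(-κ) * t) (√(-κ) * t')
    have h6 : √(-κ) * t - √(-κ) * t' = 0 := by
      by_contra hne
      linarith [one_lt_cosh.2 hne]
    have e' : t = t' := mul_left_cancel₀ hs.ne' (sub_eq_zero.1 h6)
    subst e'
    refine ⟨rfl, ?_⟩
    have : sinh (√(-κ) * t) * sinh (√(-κ) * t) * (1 - cos θ) = 0 := le_antisymm (by linarith) hp
    rcases mul_eq_zero.1 this with h | h
    · have h7 := mul_self_eq_zero.1 h
      rw [sinh_eq_zero] at h7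
      exact Or.inl ((mul_eq_zero.1 h7).resolve_left hs.ne')
    · exact Or.inr (by linarith)

/-- The distance of the κ-cone: the law of cosines of curvature `κ` with the angle
`min π (dist y y')`. -/
noncomputable def KCone.cdist (κ : ℝ) {Y : Type u} [MetricSpace Y] (x x' : KCone κ Y) : ℝ :=
  Quotient.liftOn₂ x x' (fun a b => coneLaw κ a.1 b.1 (min π (dist a.2 b.2))) (by
    have key : ∀ a b a' : coneRadii κ × Y, (a = a' ∨ ((a.1 : ℝ) = 0 ∧ (a'.1 : ℝ) = 0)) →
        coneLaw κ a.1 b.1 (min π (dist a.2 b.2)) = coneLaw κ a'.1 b.1 (min π (dist a'.2 b.2)) := by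
      rintro a b a' (rfl | ⟨h, h'⟩)
      · rfl
      · rw [h, h']; exact coneLaw_zero_left _ _ _ _
    intro a b a' b' ha hb
    refine (key a b a' ha).trans ?_
    rw [coneLaw_comm, dist_comm, coneLaw_comm _ (a'.1 : ℝ) b'.1, dist_comm a'.2 b'.2]
    exact key b a' b' hb)

noncomputable instance KCone.instMetricSpace (κ : ℝ) (Y : Type u) [MetricSpace Y] :
    MetricSpace (KCone κ Y) where
  dist x x' := KCone.cdist κ x x'
  dist_self x := by
    induction x using Quotient.inductionOn with
    | h a =>
      change coneLaw κ a.1 a.1 (min π (dist a.2 a.2)) = 0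
      rw [dist_self, min_eq_right pi_pos.le]
      exact coneLaw_self
  dist_comm x y := by
    induction x, y using Quotient.inductionOn₂ with
    | h a b =>
      change coneLaw κ a.1 b.1 (min π (dist a.2 b.2)) = coneLaw κ b.1 a.1 (min π (dist b.2 a.2))
      rw [coneLaw_comm, dist_comm]
  dist_triangle x y z := by
    induction x, y, z using Quotient.inductionOn₃ with
    | h a b c =>
      change coneLaw κ a.1 c.1 (min π (dist a.2 c.2)) ≤
        coneLaw κ a.1 b.1 (min π (dist a.2 b.2)) + coneLaw κ b.1 c.1 (min π (dist b.2 c.2))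
      have hn : ∀ y y' : Y, 0 ≤ min π (dist y y') := fun y y' => le_min pi_pos.le dist_nonneg
      refine coneLaw_triangle a.1.2 b.1.2 c.1.2 (hn _ _) (min_le_left _ _)
        (min_le_left _ _) (hn _ _) (min_le_left _ _) ?_
      have h := dist_triangle a.2 b.2 c.2
      have h1 := hn a.2 b.2
      have h2 := hn b.2 c.2
      rcases le_total π (dist a.2 b.2) with h3 | h3
      · have := min_le_left π (dist a.2 c.2)
        rw [min_eq_left h3]; linarith
      · rcases le_total π (dist b.2 c.2) with h4 | h4
        · have := min_le_left π (dist a.2 c.2)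
          rw [min_eq_left h4]; linarith
        · have := min_le_right π (dist a.2 c.2)
          rw [min_eq_right h3, min_eq_right h4]; linarith
  eq_of_dist_eq_zero := by
    intro x y
    induction x, y using Quotient.inductionOn₂ with
    | h a b =>
      intro hd
      change coneLaw κ a.1 b.1 (min π (dist a.2 b.2)) = 0 at hd
      obtain ⟨h1, h2⟩ := coneLaw_eq_zero a.1.2 b.1.2 hd
      apply Quotient.sound
      rcases h2 with h2 | h2
      · exact Or.inr ⟨h2, h1 ▸ h2⟩
      · left
        have hn : 0 ≤ min π (dist a.2 b.2) := le_min pi_pos.le dist_nonneg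
        have hm : min π (dist a.2 b.2) ≤ π := min_le_left _ _
        have h3 := (cos_eq_one_iff_of_lt_of_lt (by linarith [pi_pos]) (by linarith [pi_pos])).1 h2
        have h4 : dist a.2 b.2 = 0 := by
          rcases min_choice π (dist a.2 b.2) with h | h
          · exact absurd (h ▸ h3) pi_ne_zero
          · exact h ▸ h3
        exact Prod.ext (Subtype.ext h1) (dist_eq_zero.1 h4)

end CatSpaces

open Real

/-! ### Generalized trigonometric functions -/

/-! Let `md κ` be the primitive of `sn κ` that vanishes at `0`. For every `κ` the law of cosines
then takes the single form `md c = md a + md b - κ md a md b - sn a sn b cos θ` (`md_coneLaw`), and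
since `md κ` increases up to `π / √κ`, distances can be compared through it.

Once geodesics exist, CAT(κ) is equivalent to a Stewart inequality (`StewartIneq`): for `m` between
`p` and `q`, `md (dist w m)` is bounded by a combination of `md (dist w p)` and `md (dist w q)`,
with equality in the model plane (`modelDist_stewart`). The coefficients are nonnegative, so two
applications of it recover the comparison of arbitrary points on two sides
(`StewartIneq.dist_le_of_comparison`).

In the cone, take endpoints of radii `t₁`, `t₂` at distance `l` and a point of radius `ρ` between
them, at distances `s` and `r` from them; let `w` have radius `t`. The radii satisfy the planar
Stewart identity (`cone_radial`), so by the law of cosines the Stewart defect collapses to `sn t *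
(sn l sn ρ cos c - sn r sn t₁ cos a - sn s sn t₂ cos b)`, where `a`, `b`, `c` are truncated
distances in `Y` (`stewart_defect`). Away from the apex the angles `φ`, `ψ` of the two parts add up
to the whole angle `θ` (`angle_add_of_collinear`), and `sn l sn ρ sin φ = sn s sn t₂ sin θ`, `sn l
sn ρ sin ψ = sn r sn t₁ sin θ`. Multiplied by `sin θ`, the bracket becomes `sn l sn ρ * (sin θ cos c
- sin ψ cos a - sin φ cos b)`, which is the Stewart defect of curvature `1` in `Y`. Thus the two
Stewart inequalities agree up to positive factors; the exceptions are large perimeters in `Y`, `θ =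
0`, `θ = π` and zero radii, treated directly.

Geodesics transfer through polar coordinates: planar segments lift to the cone along geodesics of
`Y`, and the directions along a cone geodesic between points of equal radius trace a geodesic of
`Y`. -/

/-- The generalized sine of curvature `κ`. -/
noncomputable def sn (κ x : ℝ) : ℝ :=
  if κ = 0 then x else if 0 < κ then sin (√κ * x) / √κ else sinh (√(-κ) * x) / √(-κ)

/-- The generalized cosine of curvature `κ`. -/
noncomputable def cs (κ x : ℝ) : ℝ :=
  if κ = 0 then 1 else if 0 < κ then cos (√κ * x) else cosh (√(-κ) * x)

/-- The modified distance: the primitive of `sn κ` that vanishes at `0`. -/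
noncomputable def md (κ x : ℝ) : ℝ := if κ = 0 then x ^ 2 / 2 else (1 - cs κ x) / κ

theorem cs_eq_one_sub (κ x : ℝ) : cs κ x = 1 - κ * md κ x := by
  by_cases h : κ = 0
  · simp [cs, h]
  · simp only [md, h, if_false]; field_simp; ring

theorem cs_sq_add (κ x : ℝ) : cs κ x ^ 2 + κ * sn κ x ^ 2 = 1 := by
  unfold cs sn
  split_ifs with h h'
  · simp [h]
  · have := sq_sqrt h'.le
    have h2 := (sqrt_pos.2 h').ne'
    rw [div_pow, this]; field_simp; linarith [sin_sq_add_cos_sq (√κ * x)]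
  · have hk : 0 < -κ := by
      rcases lt_or_gt_of_ne h with h | h
      · linarith
      · exact absurd h h'
    have := sq_sqrt hk.le
    rw [div_pow, this]; field_simp; linarith [cosh_sq (√(-κ) * x)]

@[simp] theorem sn_zero (κ : ℝ) : sn κ 0 = 0 := by simp [sn]
@[simp] theorem cs_zero (κ : ℝ) : cs κ 0 = 1 := by simp [cs]
@[simp] theorem md_zero (κ : ℝ) : md κ 0 = 0 := by simp [md]

theorem sn_neg (κ x : ℝ) : sn κ (-x) = -sn κ x := by
  unfold sn; split_ifs <;> simp [neg_div]

theorem cs_neg (κ x : ℝ) : cs κ (-x) = cs κ x := by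
  unfold cs; split_ifs <;> simp

theorem md_neg (κ x : ℝ) : md κ (-x) = md κ x := by
  unfold md; rw [cs_neg]; simp

theorem md_abs (κ x : ℝ) : md κ |x| = md κ x := by
  rcases abs_choice x with h | h <;> rw [h]
  exact md_neg κ x

theorem sn_sub (κ a b : ℝ) : sn κ (a - b) = sn κ a * cs κ b - cs κ a * sn κ b := by
  unfold sn cs
  split_ifs with h h'
  · ring
  · rw [mul_sub, sin_sub]; ring
  · rw [mul_sub, sinh_sub]; ring

theorem cs_sub (κ a b : ℝ) : cs κ (a - b) = cs κ a * cs κ b + κ * (sn κ a * sn κ b) := by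
  unfold sn cs
  split_ifs with h h'
  · simp [h]
  · rw [mul_sub, cos_sub]
    have h2 := (sqrt_pos.2 h').ne'
    have := sq_sqrt h'.le
    field_simp
    linear_combination (sin (√κ * a) * sin (√κ * b)) * this
  · have hk : 0 < -κ := by
      rcases lt_or_gt_of_ne h with h | h
      · linarith
      · exact absurd h h'
    rw [mul_sub, cosh_sub]
    have h2 := (sqrt_pos.2 hk).ne'
    have := sq_sqrt hk.le
    field_simp
    linear_combination (sinh (√(-κ) * a) * sinh (√(-κ) * b)) * -this

theorem md_sub (κ a b : ℝ) :
    md κ (a - b) = md κ a + md κ b - κ * md κ a * md κ b - sn κ a * sn κ b := by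
  by_cases h : κ = 0
  · simp [sn, md, h]; ring
  · have h1 := cs_sub κ a b
    simp only [cs_eq_one_sub] at h1
    apply mul_left_cancel₀ h
    linear_combination -h1

theorem sn_add (κ a b : ℝ) : sn κ (a + b) = sn κ a * cs κ b + cs κ a * sn κ b := by
  rw [← sub_neg_eq_add, sn_sub, cs_neg, sn_neg]; ring

theorem md_add (κ a b : ℝ) :
    md κ (a + b) = md κ a + md κ b - κ * md κ a * md κ b + sn κ a * sn κ b := by
  rw [← sub_neg_eq_add, md_sub, md_neg, sn_neg]; ring

/-! ### Signs and monotonicity up to `π / √κ` -/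

theorem continuous_sn (κ : ℝ) : Continuous (sn κ) := by
  unfold sn; split_ifs <;> fun_prop

theorem sqrt_mul_lt_pi {κ x : ℝ} (hκ : 0 < κ) (h : x < π / √κ) : √κ * x < π := by
  have := sqrt_pos.2 hκ
  rwa [lt_div_iff₀ this, mul_comm] at h

theorem sqrt_mul_le_pi {κ x : ℝ} (hκ : 0 < κ) (h : x ≤ π / √κ) : √κ * x ≤ π := by
  have := sqrt_pos.2 hκ
  rwa [le_div_iff₀ this, mul_comm] at h

theorem sn_pos {κ x : ℝ} (h0 : 0 < x) (h : 0 < κ → x < π / √κ) : 0 < sn κ x := by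
  unfold sn
  split_ifs with h1 h2
  · exact h0
  · have := sqrt_pos.2 h2
    exact div_pos (sin_pos_of_pos_of_lt_pi (by positivity) (sqrt_mul_lt_pi h2 (h h2))) this
  · have : 0 < √(-κ) := sqrt_pos.2 (by rcases lt_or_gt_of_ne h1 with h | h <;> grind)
    exact div_pos (sinh_pos_iff.2 (by positivity)) this

theorem sn_nonneg {κ x : ℝ} (h0 : 0 ≤ x) (h : 0 < κ → x ≤ π / √κ) : 0 ≤ sn κ x := by
  unfold sn
  split_ifs with h1 h2
  · exact h0
  · exact div_nonneg (sin_nonneg_of_nonneg_of_le_pi (by positivity) (sqrt_mul_le_pi h2 (h h2)))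
      (sqrt_nonneg _)
  · exact div_nonneg (sinh_nonneg_iff.2 (by positivity)) (sqrt_nonneg _)

theorem md_strictMonoOn (κ : ℝ) :
    StrictMonoOn (md κ) {x | 0 ≤ x ∧ (0 < κ → x ≤ π / √κ)} := by
  rintro a ⟨ha, ha'⟩ b ⟨hb, hb'⟩ hab
  unfold md cs
  split_ifs with h1 h2
  · have := pow_lt_pow_left₀ hab ha two_ne_zero
    linarith
  · have hs := sqrt_pos.2 h2
    have := cos_lt_cos_of_nonneg_of_le_pi (mul_nonneg hs.le ha) (sqrt_mul_le_pi h2 (hb' h2))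
      (mul_lt_mul_of_pos_left hab hs)
    exact div_lt_div_of_pos_right (by linarith) h2
  · have hk : κ < 0 := lt_of_le_of_ne (not_lt.1 h2) h1
    have hs : 0 < √(-κ) := sqrt_pos.2 (by linarith)
    have : cosh (√(-κ) * a) < cosh (√(-κ) * b) := by
      rw [cosh_lt_cosh, abs_of_nonneg (by positivity), abs_of_nonneg (by positivity)]
      exact mul_lt_mul_of_pos_left hab hs
    exact div_lt_div_of_neg_of_lt hk (by linarith)

/-- Only `a` needs an upper bound: if `b < a`, then `b` lies in the range of monotonicity as well.
-/
theorem le_of_md_le {κ a b : ℝ} (ha : 0 ≤ a) (ha' : 0 < κ → a ≤ π / √κ) (hb : 0 ≤ b)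
    (h : md κ a ≤ md κ b) : a ≤ b := by
  by_contra hab
  push Not at hab
  exact absurd (md_strictMonoOn κ ⟨hb, fun hk => hab.le.trans (ha' hk)⟩ ⟨ha, ha'⟩ hab) (not_lt.2 h)

theorem md_le_md {κ a b : ℝ} (ha : 0 ≤ a) (hab : a ≤ b) (hb : 0 < κ → b ≤ π / √κ) :
    md κ a ≤ md κ b :=
  (md_strictMonoOn κ).monotoneOn ⟨ha, fun h => hab.trans (hb h)⟩ ⟨ha.trans hab, hb⟩ hab

theorem eq_of_md_eq {κ a b : ℝ} (ha : 0 ≤ a) (ha' : 0 < κ → a ≤ π / √κ) (hb : 0 ≤ b)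
    (hb' : 0 < κ → b ≤ π / √κ) (h : md κ a = md κ b) : a = b :=
  le_antisymm (le_of_md_le ha ha' hb h.le) (le_of_md_le hb hb' ha h.ge)

/-! ### The law of cosines -/

theorem coneLaw_nonneg {κ t t' : ℝ} (ht : 0 ≤ t) (ht' : 0 ≤ t') (θ : ℝ) :
    0 ≤ coneLaw κ t t' θ := by
  unfold coneLaw
  split_ifs with h h'
  · positivity
  · exact div_nonneg (arccos_nonneg _) (sqrt_nonneg _)
  · exact div_nonneg (arcosh_nonneg (one_le_hyperbolicLaw (by positivity) (by positivity) θ))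
      (sqrt_nonneg _)

theorem coneLaw_le {κ : ℝ} (t t' θ : ℝ) (h : 0 < κ) : coneLaw κ t t' θ ≤ π / √κ := by
  unfold coneLaw
  rw [if_neg h.ne', if_pos h]
  exact div_le_div_of_nonneg_right (arccos_le_pi _) (sqrt_nonneg _)

theorem md_coneLaw {κ t t' : ℝ} (ht : 0 ≤ t) (ht' : 0 ≤ t') (θ : ℝ) :
    md κ (coneLaw κ t t' θ)
      = md κ t + md κ t' - κ * md κ t * md κ t' - sn κ t * sn κ t' * cos θ := by
  by_cases h : κ = 0
  · have : 0 ≤ t ^ 2 + t' ^ 2 - 2 * t * t' * cos θ := by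
      nlinarith [sq_nonneg (t - t'), mul_nonneg (mul_nonneg ht ht') (sub_nonneg.2 (cos_le_one θ))]
    simp only [md, sn, coneLaw, h, if_true, sq_sqrt this]
    ring
  · have key : cs κ (coneLaw κ t t' θ) = cs κ t * cs κ t' + κ * (sn κ t * sn κ t' * cos θ) := by
      unfold cs sn coneLaw
      simp only [h, if_false]
      split_ifs with h'
      · have hs := (sqrt_pos.2 h').ne'
        have hq := sq_sqrt h'.le
        rw [mul_div_cancel₀ _ hs, cos_arccos]
        · field_simp
          linear_combination (sin (√κ * t) * sin (√κ * t') * cos θ) * hq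
        -- The argument of `arccos` is the inner product of two unit vectors `u`, `v` of `ℝ³`; the
        -- squares are the coordinates of `|u + v|²` here and of `|u - v|²` in the next bound.
        · nlinarith [sin_sq_add_cos_sq (√κ * t), sin_sq_add_cos_sq (√κ * t'), neg_one_le_cos θ,
            cos_le_one θ, sin_sq_add_cos_sq θ, sq_nonneg (cos (√κ * t) + cos (√κ * t')),
            sq_nonneg (sin (√κ * t) + sin (√κ * t') * cos θ),
            sq_nonneg (sin (√κ * t') * sin θ)]
        · nlinarith [sin_sq_add_cos_sq (√κ * t), sin_sq_add_cos_sq (√κ * t'),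
            sin_sq_add_cos_sq θ, sq_nonneg (cos (√κ * t) - cos (√κ * t')),
            sq_nonneg (sin (√κ * t) - sin (√κ * t') * cos θ),
            sq_nonneg (sin (√κ * t') * sin θ)]
      · have hk : 0 < -κ := by
          rcases lt_or_gt_of_ne h with h | h
          · linarith
          · exact absurd h h'
        have hs := (sqrt_pos.2 hk).ne'
        have hq := sq_sqrt hk.le
        rw [mul_div_cancel₀ _ hs,
          cosh_arcosh (one_le_hyperbolicLaw (by positivity) (by positivity) θ)]
        field_simp
        linear_combination (sinh (√(-κ) * t) * sinh (√(-κ) * t') * cos θ) * -hq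
    simp only [cs_eq_one_sub] at key
    apply mul_left_cancel₀ h
    linear_combination -key

/-! ### The model plane in ambient coordinates -/

/-- The bilinear form on `ℝ³` whose unit vectors form the model plane of curvature `κ ≠ 0`. -/
noncomputable def modelForm (κ : ℝ) (v w : EuclideanSpace ℝ (Fin 3)) : ℝ :=
  v 2 * w 2 + (if 0 < κ then 1 else -1) * (v 0 * w 0 + v 1 * w 1)

theorem modelForm_self {κ : ℝ} (h : κ ≠ 0) {v : EuclideanSpace ℝ (Fin 3)}
    (hv : v ∈ modelCarrier κ) : modelForm κ v v = 1 := by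
  unfold modelForm
  split_ifs with h'
  · linarith [hv.2.1 h']
  · linarith [(hv.2.2 (lt_of_le_of_ne (not_lt.1 h') h)).1]

theorem cs_modelDist {κ : ℝ} (h : κ ≠ 0) {v w : EuclideanSpace ℝ (Fin 3)}
    (hv : v ∈ modelCarrier κ) (hw : w ∈ modelCarrier κ) :
    cs κ (modelDist κ v w) = modelForm κ v w := by
  unfold cs modelDist modelForm
  simp only [h, if_false]
  split_ifs with h'
  · have := sphere_abs_le (hv.2.1 h') (hw.2.1 h')
    rw [mul_div_cancel₀ _ (sqrt_pos.2 h').ne', cos_arccos this.1 this.2]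
    ring
  · have hk : κ < 0 := lt_of_le_of_ne (not_lt.1 h') h
    have a := hv.2.2 hk
    have b := hw.2.2 hk
    rw [mul_div_cancel₀ _ (sqrt_pos.2 (by linarith)).ne',
      cosh_arcosh (one_le_hyperboloid a.1 a.2 b.1 b.2)]
    ring

theorem md_modelDist_zero {v w : EuclideanSpace ℝ (Fin 3)}
    (hv : v ∈ modelCarrier 0) (hw : w ∈ modelCarrier 0) :
    md 0 (modelDist 0 v w) = ((v 0 - w 0) ^ 2 + (v 1 - w 1) ^ 2) / 2 := by
  simp only [md, modelDist, if_true]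
  rw [EuclideanSpace.dist_eq, sq_sqrt (by positivity)]
  simp [Fin.sum_univ_three, Real.dist_eq, sq_abs, hv.1 rfl, hw.1 rfl]

theorem modelDist_nonneg {κ : ℝ} {v w : EuclideanSpace ℝ (Fin 3)}
    (hv : v ∈ modelCarrier κ) (hw : w ∈ modelCarrier κ) : 0 ≤ modelDist κ v w := by
  unfold modelDist
  split_ifs with h h'
  · exact dist_nonneg
  · exact div_nonneg (arccos_nonneg _) (sqrt_nonneg _)
  · have hk : κ < 0 := lt_of_le_of_ne (not_lt.1 h') h
    have a := hv.2.2 hk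
    have b := hw.2.2 hk
    exact div_nonneg (arcosh_nonneg (one_le_hyperboloid a.1 a.2 b.1 b.2)) (sqrt_nonneg _)

theorem modelDist_le {κ : ℝ} (v w : EuclideanSpace ℝ (Fin 3)) (h : 0 < κ) :
    modelDist κ v w ≤ π / √κ := by
  unfold modelDist
  rw [if_neg h.ne', if_pos h]
  exact div_le_div_of_nonneg_right (arccos_le_pi _) (sqrt_nonneg _)

/-- For `κ ≠ 0` the difference of the two sides is a null vector orthogonal to `m` for `modelForm`.
The form is definite if `κ > 0`, and definite on the orthogonal complement of `m` if `κ < 0`, so the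
vector is zero. For `κ = 0` the squared length of the difference is computed to be zero. -/
theorem sn_mul_eq_of_collinear {κ : ℝ} {p m q : EuclideanSpace ℝ (Fin 3)}
    (hp : p ∈ modelCarrier κ) (hm : m ∈ modelCarrier κ) (hq : q ∈ modelCarrier κ)
    (h : modelDist κ p m + modelDist κ m q = modelDist κ p q) (i : Fin 3) :
    sn κ (modelDist κ p q) * m i
      = sn κ (modelDist κ m q) * p i + sn κ (modelDist κ p m) * q i := by
  by_cases h0 : κ = 0
  · subst h0
    have e1 := md_modelDist_zero hp hm
    have e2 := md_modelDist_zero hm hq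
    have e3 := md_modelDist_zero hp hq
    rw [← h] at e3 ⊢
    generalize modelDist 0 p m = s at *
    generalize modelDist 0 m q = r at *
    simp only [md, sn, if_true] at e1 e2 e3 ⊢
    have key : (r * (p 0 - m 0) + s * (q 0 - m 0)) ^ 2
        + (r * (p 1 - m 1) + s * (q 1 - m 1)) ^ 2 = 0 := by
      linear_combination -2 * r ^ 2 * e1 - 2 * s ^ 2 * e2
        + 2 * r * s * e3 - 2 * r * s * e1 - 2 * r * s * e2
    have k0 : r * (p 0 - m 0) + s * (q 0 - m 0) = 0 := by
      refine pow_eq_zero_iff two_ne_zero |>.1 (le_antisymm ?_ (sq_nonneg _))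
      linarith [sq_nonneg (r * (p 1 - m 1) + s * (q 1 - m 1))]
    have k1 : r * (p 1 - m 1) + s * (q 1 - m 1) = 0 := by
      refine pow_eq_zero_iff two_ne_zero |>.1 (le_antisymm ?_ (sq_nonneg _))
      linarith [sq_nonneg (r * (p 0 - m 0) + s * (q 0 - m 0))]
    fin_cases i
    · simp only [Fin.zero_eta]; linarith
    · simp only [Fin.mk_one]; linarith
    · simp only [Fin.reduceFinMk, hp.1 rfl, hm.1 rfl, hq.1 rfl]; ring
  · have e1 := cs_modelDist h0 hp hm
    have e2 := cs_modelDist h0 hm hq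
    have e3 := cs_modelDist h0 hp hq
    have f1 := modelForm_self h0 hp
    have f2 := modelForm_self h0 hm
    have f3 := modelForm_self h0 hq
    have g : ∀ a b, cs κ (a + b) = cs κ a * cs κ b - κ * (sn κ a * sn κ b) := by
      intro a b
      rw [← sub_neg_eq_add, cs_sub, cs_neg, sn_neg]; ring
    rw [← h] at e3 ⊢
    rw [g] at e3
    rw [sn_add]
    have c1 := cs_sq_add κ (modelDist κ p m)
    have c2 := cs_sq_add κ (modelDist κ m q)
    rw [e1, e2] at e3 ⊢
    rw [e1] at c1
    rw [e2] at c2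
    generalize sn κ (modelDist κ p m) = S at *
    generalize sn κ (modelDist κ m q) = S' at *
    set c := S * modelForm κ m q + modelForm κ p m * S' with hc
    set v : Fin 3 → ℝ := fun i => S' * p i + S * q i - c * m i with hv
    set σ : ℝ := if 0 < κ then 1 else -1 with hσ
    have k1 : v 2 * v 2 + σ * (v 0 * v 0 + v 1 * v 1) = 0 := by
      have : v 2 * v 2 + σ * (v 0 * v 0 + v 1 * v 1) = S' ^ 2 * modelForm κ p p
          + S ^ 2 * modelForm κ q q + c ^ 2 * modelForm κ m m + 2 * S * S' * modelForm κ p q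
          - 2 * c * S' * modelForm κ p m - 2 * c * S * modelForm κ m q := by
        simp only [modelForm, hv, ← hσ]; ring
      rw [this, f1, f2, f3, ← e3]
      clear_value c
      rw [hc]
      linear_combination (-S' ^ 2) * c1 - S ^ 2 * c2
    have k2 : v 2 * m 2 + σ * (v 0 * m 0 + v 1 * m 1) = 0 := by
      have : v 2 * m 2 + σ * (v 0 * m 0 + v 1 * m 1) = S' * modelForm κ p m
          + S * modelForm κ m q - c * modelForm κ m m := by
        simp only [modelForm, hv, ← hσ]; ring
      rw [this, f2, hc]; ring
    have k3 : m 2 * m 2 + σ * (m 0 * m 0 + m 1 * m 1) = 1 := f2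
    have hz : v 0 = 0 ∧ v 1 = 0 ∧ v 2 = 0 := by
      clear_value v
      by_cases h' : 0 < κ
      · simp only [hσ, h', if_true] at k1
        refine ⟨?_, ?_, ?_⟩ <;> refine pow_eq_zero_iff two_ne_zero |>.1
          (le_antisymm ?_ (sq_nonneg _)) <;>
        linarith [mul_self_nonneg (v 0), mul_self_nonneg (v 1), mul_self_nonneg (v 2)]
      · simp only [hσ, h', if_false] at k1 k2 k3
        -- Cauchy–Schwarz in the first two coordinates: orthogonality to `m` and nullity leave `v 2
        -- ^ 2 ≤ 0`.
        have h2 : v 2 = 0 := by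
          refine pow_eq_zero_iff two_ne_zero |>.1 (le_antisymm ?_ (sq_nonneg _))
          have e : (v 2 * m 2) ^ 2 = (v 0 * m 0 + v 1 * m 1) ^ 2 := by
            congr 1; linarith
          have e' : (v 2 * m 2) ^ 2 = v 2 ^ 2 * (1 + (m 0 ^ 2 + m 1 ^ 2)) := by
            rw [mul_pow]; congr 1; linarith
          have e'' : v 2 ^ 2 = v 0 ^ 2 + v 1 ^ 2 := by linarith
          have : v 2 ^ 2 + (v 0 ^ 2 + v 1 ^ 2) * (m 0 ^ 2 + m 1 ^ 2)
              = (v 0 * m 0 + v 1 * m 1) ^ 2 := by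
            rw [← e'', ← e, e']; ring
          linarith [sq_nonneg (v 0 * m 1 - v 1 * m 0)]
        rw [h2] at k1
        refine ⟨?_, ?_, h2⟩ <;> refine pow_eq_zero_iff two_ne_zero |>.1
          (le_antisymm ?_ (sq_nonneg _)) <;>
        linarith [mul_self_nonneg (v 0), mul_self_nonneg (v 1)]
    have : ∀ i, v i = 0 := by
      intro i; fin_cases i
      exacts [hz.1, hz.2.1, hz.2.2]
    have := this i
    simp only [hv] at this
    linarith

/-- The Stewart identity in the model plane. -/
theorem modelDist_stewart {κ : ℝ} {p m q w : EuclideanSpace ℝ (Fin 3)}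
    (hp : p ∈ modelCarrier κ) (hm : m ∈ modelCarrier κ) (hq : q ∈ modelCarrier κ)
    (hw : w ∈ modelCarrier κ)
    (h : modelDist κ p m + modelDist κ m q = modelDist κ p q) :
    sn κ (modelDist κ p q) * md κ (modelDist κ w m)
      = sn κ (modelDist κ m q) * md κ (modelDist κ w p)
        + sn κ (modelDist κ p m) * md κ (modelDist κ w q)
        + (sn κ (modelDist κ p q) * md κ (modelDist κ p m)
          - sn κ (modelDist κ p m) * md κ (modelDist κ p q)) := by
  have hl := sn_mul_eq_of_collinear hp hm hq h
  by_cases h0 : κ = 0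
  · subst h0
    rw [md_modelDist_zero hw hm, md_modelDist_zero hw hp, md_modelDist_zero hw hq]
    have e1 := md_modelDist_zero hp hm
    have e2 := md_modelDist_zero hm hq
    have l0 := hl 0
    have l1 := hl 1
    rw [← h] at l0 l1 ⊢
    generalize modelDist 0 p m = s at *
    generalize modelDist 0 m q = r at *
    simp only [md, sn, if_true] at *
    linear_combination r * e1 + s * e2 - (w 0 - m 0) * l0 - (w 1 - m 1) * l1
  -- Pairing the linear relation `hl` with `w` gives the identity in terms of `cs`. Replacing `cs`
  -- by `1 - κ * md` produces the constant term, which `g2` puts into the required form.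
  · have g : sn κ (modelDist κ p q) * cs κ (modelDist κ w m)
      = sn κ (modelDist κ m q) * cs κ (modelDist κ w p)
        + sn κ (modelDist κ p m) * cs κ (modelDist κ w q) := by
      rw [cs_modelDist h0 hw hm, cs_modelDist h0 hw hp, cs_modelDist h0 hw hq]
      unfold modelForm
      generalize (if 0 < κ then (1 : ℝ) else -1) = σ
      linear_combination w 2 * hl 2 + σ * w 0 * hl 0 + σ * w 1 * hl 1
    have g2 : sn κ (modelDist κ m q) = sn κ (modelDist κ p q) * cs κ (modelDist κ p m)
        - cs κ (modelDist κ p q) * sn κ (modelDist κ p m) := by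
      rw [← sn_sub, ← h, add_sub_cancel_left]
    simp only [cs_eq_one_sub] at g g2
    apply mul_left_cancel₀ h0
    linear_combination -g - g2

/-- The point at distance `s` from `p` on the segment from `p` to `q`, which has length `l`. -/
noncomputable def modelSeg (κ l : ℝ) (p q : EuclideanSpace ℝ (Fin 3)) (s : ℝ) :
    EuclideanSpace ℝ (Fin 3) :=
  (sn κ l)⁻¹ • (sn κ (l - s) • p + sn κ s • q)

theorem modelSeg_apply (κ l : ℝ) (p q : EuclideanSpace ℝ (Fin 3)) (s : ℝ) (i : Fin 3) :
    modelSeg κ l p q s i = (sn κ l)⁻¹ * (sn κ (l - s) * p i + sn κ s * q i) := by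
  simp [modelSeg, mul_add]

/-- Bilinear expansion and the subtraction formulas. The case `s = s'` puts the segment on the model
surface, and the general case shows that it has unit speed. -/
theorem modelForm_modelSeg {κ : ℝ} (h0 : κ ≠ 0) {p q : EuclideanSpace ℝ (Fin 3)}
    (hp : p ∈ modelCarrier κ) (hq : q ∈ modelCarrier κ)
    (hl : sn κ (modelDist κ p q) ≠ 0) (s s' : ℝ) :
    modelForm κ (modelSeg κ (modelDist κ p q) p q s) (modelSeg κ (modelDist κ p q) p q s')
      = cs κ (s - s') := by
  have e := cs_modelDist h0 hp hq
  have f1 := modelForm_self h0 hp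
  have f2 := modelForm_self h0 hq
  generalize modelDist κ p q = l at *
  have : modelForm κ (modelSeg κ l p q s) (modelSeg κ l p q s')
      = (sn κ l)⁻¹ ^ 2 * (sn κ (l - s) * sn κ (l - s') * modelForm κ p p
        + sn κ s * sn κ s' * modelForm κ q q
        + (sn κ (l - s) * sn κ s' + sn κ s * sn κ (l - s')) * modelForm κ p q) := by
    simp only [modelForm, modelSeg_apply]; ring
  rw [this, f1, f2, ← e, sn_sub, sn_sub, cs_sub]
  field_simp
  have c := cs_sq_add κ l
  linear_combination (-sn κ s * sn κ s') * c

theorem modelSeg_mem {κ : ℝ} {p q : EuclideanSpace ℝ (Fin 3)}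
    (hp : p ∈ modelCarrier κ) (hq : q ∈ modelCarrier κ)
    (hl : 0 < modelDist κ p q) (hl' : 0 < κ → modelDist κ p q < π / √κ) {s : ℝ}
    (hs : s ∈ Set.Icc 0 (modelDist κ p q)) :
    modelSeg κ (modelDist κ p q) p q s ∈ modelCarrier κ := by
  have hpos := sn_pos hl hl'
  refine ⟨fun h => ?_, fun h => ?_, fun h => ⟨?_, ?_⟩⟩
  · rw [modelSeg_apply, hp.1 h, hq.1 h]; ring
  · have := modelForm_modelSeg h.ne' hp hq hpos.ne' s s
    rw [sub_self, cs_zero, modelForm, if_pos h] at this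
    linarith
  · have := modelForm_modelSeg h.ne hp hq hpos.ne' s s
    rw [sub_self, cs_zero, modelForm, if_neg h.not_gt] at this
    linarith
  · rw [modelSeg_apply]
    have h2 := (hp.2.2 h).2
    have h3 := (hq.2.2 h).2
    have a : 0 ≤ sn κ (modelDist κ p q - s) :=
      sn_nonneg (by linarith [hs.2]) (fun h' => by linarith)
    refine mul_pos (inv_pos.2 hpos) ?_
    rcases hs.1.eq_or_lt with rfl | h4
    · simp only [sub_zero, sn_zero, zero_mul, add_zero]; positivity
    · have : 0 < sn κ s := sn_pos h4 (fun h' => by linarith)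
      positivity

theorem modelDist_modelSeg {κ : ℝ} {p q : EuclideanSpace ℝ (Fin 3)}
    (hp : p ∈ modelCarrier κ) (hq : q ∈ modelCarrier κ)
    (hl : 0 < modelDist κ p q) (hl' : 0 < κ → modelDist κ p q < π / √κ) {s s' : ℝ}
    (hs : s ∈ Set.Icc 0 (modelDist κ p q)) (hs' : s' ∈ Set.Icc 0 (modelDist κ p q)) :
    modelDist κ (modelSeg κ (modelDist κ p q) p q s) (modelSeg κ (modelDist κ p q) p q s')
      = |s - s'| := by
  have hpos := sn_pos hl hl'
  have m1 := modelSeg_mem hp hq hl hl' hs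
  have m2 := modelSeg_mem hp hq hl hl' hs'
  have hle : |s - s'| ≤ modelDist κ p q := abs_le.2 ⟨by linarith [hs.1, hs'.2], by
    linarith [hs.2, hs'.1]⟩
  refine eq_of_md_eq (κ := κ) (modelDist_nonneg m1 m2) (modelDist_le _ _) (abs_nonneg _)
    (fun h => hle.trans (hl' h).le) ?_
  rw [md_abs]
  by_cases h0 : κ = 0
  · subst h0
    rw [md_modelDist_zero m1 m2]
    have e := md_modelDist_zero hp hq
    simp only [modelSeg_apply]
    generalize modelDist 0 p q = l at *
    simp only [md, sn, if_true] at e hpos ⊢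
    field_simp
    linear_combination (-(s - s') ^ 2 * 2) * e
  · have := cs_modelDist h0 m1 m2
    rw [modelForm_modelSeg h0 hp hq hpos.ne'] at this
    simp only [cs_eq_one_sub] at this
    apply mul_left_cancel₀ h0
    linarith

theorem modelSeg_zero {κ l : ℝ} (h : sn κ l ≠ 0) (p q : EuclideanSpace ℝ (Fin 3)) :
    modelSeg κ l p q 0 = p := by
  simp [modelSeg, h]

theorem modelSeg_length {κ l : ℝ} (h : sn κ l ≠ 0) (p q : EuclideanSpace ℝ (Fin 3)) :
    modelSeg κ l p q l = q := by
  simp [modelSeg, h]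

theorem ModelPlane.exists_isGeodesic {κ : ℝ} (p q : ModelPlane κ)
    (h : 0 < κ → dist p q < π / √κ) : ∃ c, IsGeodesic c (dist p q) p q := by
  rcases (dist_nonneg (x := p) (y := q)).eq_or_lt with h0 | h0
  · refine ⟨fun _ => p, dist_nonneg, rfl, dist_eq_zero.1 h0.symm, fun t ht t' ht' => ?_⟩
    rw [← h0] at ht ht'
    rw [le_antisymm ht.2 ht.1, le_antisymm ht'.2 ht'.1]; simp
  · have hd : dist p q = modelDist κ p.1 q.1 := rfl
    rw [hd] at h h0 ⊢
    have hpos : sn κ (modelDist κ p.1 q.1) ≠ 0 := (sn_pos h0 h).ne'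
    -- Outside the interval the curve takes the default value `p`.
    have : ∀ s, ∃ x : ModelPlane κ, s ∈ Set.Icc 0 (modelDist κ p.1 q.1) →
        x.1 = modelSeg κ (modelDist κ p.1 q.1) p.1 q.1 s := by
      intro s
      by_cases hs : s ∈ Set.Icc 0 (modelDist κ p.1 q.1)
      · exact ⟨⟨_, modelSeg_mem p.2 q.2 h0 h hs⟩, fun _ => rfl⟩
      · exact ⟨p, fun h => absurd h hs⟩
    choose f hf using this
    refine ⟨f, h0.le, ?_, ?_, fun t ht t' ht' => ?_⟩
    · exact Subtype.ext ((hf _ ⟨le_rfl, h0.le⟩).trans (modelSeg_zero hpos _ _))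
    · exact Subtype.ext ((hf _ ⟨h0.le, le_rfl⟩).trans (modelSeg_length hpos _ _))
    · change modelDist κ (f t).1 (f t').1 = _
      rw [hf t ht, hf t' ht']
      exact modelDist_modelSeg p.2 q.2 h0 h ht ht'

/-! ### Comparison triangles -/

/-- The law of cosines is solved for `cos θ`. The solution lies in `[-1, 1]` because `md (a - b) ≤
md c ≤ md (a + b)`, by the triangle inequalities and the perimeter bound. -/
theorem exists_coneLaw_eq {κ a b c : ℝ} (ha : 0 ≤ a) (hb : 0 ≤ b) (hc : 0 ≤ c)
    (h1 : a ≤ b + c) (h2 : b ≤ a + c) (h3 : c ≤ a + b)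
    (h : 0 < κ → a + b + c < 2 * (π / √κ)) : ∃ θ, coneLaw κ a b θ = c := by
  suffices ∃ x, -1 ≤ x ∧ x ≤ 1 ∧
      md κ c = md κ a + md κ b - κ * md κ a * md κ b - sn κ a * sn κ b * x by
    obtain ⟨x, hx, hx', e⟩ := this
    refine ⟨arccos x, eq_of_md_eq (κ := κ) (coneLaw_nonneg ha hb _) (coneLaw_le _ _ _) hc
      (fun hk => by linarith [h hk]) ?_⟩
    rw [md_coneLaw ha hb, cos_arccos hx hx', e]
  rcases ha.eq_or_lt with rfl | ha
  · refine ⟨0, by norm_num, by norm_num, ?_⟩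
    rw [le_antisymm (a := c) (b := b) (by linarith) (by linarith)]; simp
  rcases hb.eq_or_lt with rfl | hb
  · refine ⟨0, by norm_num, by norm_num, ?_⟩
    rw [le_antisymm (a := c) (b := a) (by linarith) (by linarith)]; simp
  have sa : 0 < sn κ a := sn_pos ha (fun hk => by linarith [h hk])
  have sb : 0 < sn κ b := sn_pos hb (fun hk => by linarith [h hk])
  have l1 : md κ (a - b) ≤ md κ c := by
    rw [← md_abs]
    exact md_le_md (abs_nonneg _) (abs_le.2 ⟨by linarith, by linarith⟩)
      (fun hk => by linarith [h hk])
  have l2 : md κ c ≤ md κ (a + b) := by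
    -- Past `π / √κ` the function `md` decreases; reflecting `a + b` in this point gives `2 * (π /
    -- √κ) - (a + b)`, which still exceeds `c` by the perimeter bound.
    by_cases hab : 0 < κ ∧ π / √κ < a + b
    · have : md κ (a + b) = md κ (2 * (π / √κ) - (a + b)) := by
        have hs := (sqrt_pos.2 hab.1).ne'
        unfold md cs
        simp only [hab.1.ne', hab.1, if_true, if_false]
        rw [mul_sub, show √κ * (2 * (π / √κ)) = 2 * π by field_simp, cos_two_pi_sub]
      rw [this]
      exact md_le_md hc (by linarith [h hab.1]) (fun _ => by linarith)
    · exact md_le_md hc h3 (fun hk => not_lt.1 fun h' => hab ⟨hk, h'⟩)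
  rw [md_sub] at l1
  rw [md_add] at l2
  refine ⟨(md κ a + md κ b - κ * md κ a * md κ b - md κ c) / (sn κ a * sn κ b), ?_, ?_, ?_⟩
  · rw [le_div_iff₀ (by positivity)]; linarith
  · rw [div_le_iff₀ (by positivity)]; linarith
  · field_simp; ring

theorem ModelPlane.exists_triangle {κ a b c : ℝ} (ha : 0 ≤ a) (hb : 0 ≤ b) (hc : 0 ≤ c)
    (h1 : a ≤ b + c) (h2 : b ≤ a + c) (h3 : c ≤ a + b)
    (h : 0 < κ → a + b + c < 2 * (π / √κ)) :
    ∃ T : GeodesicTriangle (ModelPlane κ),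
      dist T.p T.q = a ∧ dist T.q T.r = c ∧ dist T.r T.p = b := by
  obtain ⟨θ, e⟩ := exists_coneLaw_eq ha hb hc h1 h2 h3 h
  let p : ModelPlane κ := ⟨modelPolar κ 0 0, modelPolar_mem _ _ _⟩
  let q : ModelPlane κ := ⟨modelPolar κ a θ, modelPolar_mem _ _ _⟩
  let r : ModelPlane κ := ⟨modelPolar κ b 0, modelPolar_mem _ _ _⟩
  have hr : ∀ x, 0 ≤ x → (0 < κ → x ≤ π / √κ) → ∀ ψ, coneLaw κ 0 x ψ = x := by
    intro x hx hx' ψ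
    refine eq_of_md_eq (κ := κ) (coneLaw_nonneg le_rfl hx _) (coneLaw_le _ _ _) hx hx' ?_
    rw [md_coneLaw le_rfl hx]; simp
  have e1 : dist p q = a := (modelDist_modelPolar _ _ _ _ _).trans
    (hr _ ha (fun hk => by linarith [h hk]) _)
  have e2 : dist q r = c := (modelDist_modelPolar _ _ _ _ _).trans (by rw [sub_zero, e])
  have e3 : dist r p = b := (dist_comm _ _).trans ((modelDist_modelPolar _ _ _ _ _).trans
    (hr _ hb (fun hk => by linarith [h hk]) _))
  obtain ⟨c1, i1⟩ := ModelPlane.exists_isGeodesic p q (fun hk => by linarith [h hk])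
  obtain ⟨c2, i2⟩ := ModelPlane.exists_isGeodesic q r (fun hk => by linarith [h hk])
  obtain ⟨c3, i3⟩ := ModelPlane.exists_isGeodesic r p (fun hk => by linarith [h hk])
  exact ⟨⟨p, q, r, _, _, _, ⟨c1, _, i1, rfl⟩, ⟨c2, _, i2, rfl⟩, ⟨c3, _, i3, rfl⟩⟩, e1, e2, e3⟩

/-! ### The CAT(κ) condition as a Stewart inequality -/

/-- The Stewart inequality of curvature `κ`: the distance from a vertex of a triangle to a point
of the opposite side is at most the corresponding distance in the model plane. -/
def StewartIneq (κ : ℝ) (X : Type u) [MetricSpace X] : Prop :=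
  ∀ w p q m : X, dist p m + dist m q = dist p q →
    (0 < κ → dist w p + dist w q + dist p q < 2 * (π / √κ)) →
    sn κ (dist p q) * md κ (dist w m)
      ≤ sn κ (dist m q) * md κ (dist w p) + sn κ (dist p m) * md κ (dist w q)
        + (sn κ (dist p q) * md κ (dist p m) - sn κ (dist p m) * md κ (dist p q))

/-! ### Distances along geodesics and segments -/

theorem IsGeodesic.length_eq {X : Type u} [MetricSpace X] {c : ℝ → X} {l : ℝ} {x y : X}
    (h : IsGeodesic c l x y) : l = dist x y := by
  have := h.2.2.2 0 ⟨le_rfl, h.1⟩ l ⟨h.1, le_rfl⟩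
  rw [h.2.1, h.2.2.1, zero_sub, abs_neg, abs_of_nonneg h.1] at this
  exact this.symm

theorem IsGeodesic.dist_left {X : Type u} [MetricSpace X] {c : ℝ → X} {l : ℝ} {x y : X}
    (h : IsGeodesic c l x y) {s : ℝ} (hs : s ∈ Set.Icc 0 l) : dist x (c s) = s := by
  have := h.2.2.2 0 ⟨le_rfl, h.1⟩ s hs
  rwa [h.2.1, zero_sub, abs_neg, abs_of_nonneg hs.1] at this

theorem IsGeodesic.dist_right {X : Type u} [MetricSpace X] {c : ℝ → X} {l : ℝ} {x y : X}
    (h : IsGeodesic c l x y) {s : ℝ} (hs : s ∈ Set.Icc 0 l) : dist (c s) y = l - s := by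
  have := h.2.2.2 s hs l ⟨h.1, le_rfl⟩
  rwa [h.2.2.1, abs_sub_comm, abs_of_nonneg (sub_nonneg.2 hs.2)] at this

theorem IsGeodesicSegment.dist_add {X : Type u} [MetricSpace X] {S : Set X} {x y z : X}
    (h : IsGeodesicSegment S x y) (hz : z ∈ S) : dist x z + dist z y = dist x y := by
  obtain ⟨c, l, hc, rfl⟩ := h
  obtain ⟨s, hs, rfl⟩ := hz
  rw [hc.dist_left hs, hc.dist_right hs, ← hc.length_eq]; ring

theorem IsGeodesicSegment.dist_eq {X : Type u} [MetricSpace X] {S : Set X} {x y z z' : X}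
    (h : IsGeodesicSegment S x y) (hz : z ∈ S) (hz' : z' ∈ S) :
    dist z z' = |dist x z - dist x z'| := by
  obtain ⟨c, l, hc, rfl⟩ := h
  obtain ⟨s, hs, rfl⟩ := hz
  obtain ⟨s', hs', rfl⟩ := hz'
  rw [hc.dist_left hs, hc.dist_left hs', hc.2.2.2 s hs s' hs']

theorem IsGeodesicSegment.left_mem {X : Type u} [MetricSpace X] {S : Set X} {x y : X}
    (h : IsGeodesicSegment S x y) : x ∈ S := by
  obtain ⟨c, l, hc, rfl⟩ := h
  exact ⟨0, ⟨le_rfl, hc.1⟩, hc.2.1⟩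

theorem IsGeodesicSegment.exists_mem {X : Type u} [MetricSpace X] {S : Set X} {x y : X}
    (h : IsGeodesicSegment S x y) {s : ℝ} (hs : s ∈ Set.Icc 0 (dist x y)) :
    ∃ z ∈ S, dist x z = s := by
  obtain ⟨c, l, hc, rfl⟩ := h
  rw [← hc.length_eq] at hs
  exact ⟨c s, ⟨s, hs, rfl⟩, hc.dist_left hs⟩

/-- The concatenation of two geodesics whose lengths add up to the distance of the endpoints. -/
theorem IsGeodesic.concat {X : Type u} [MetricSpace X] {c c' : ℝ → X} {l l' : ℝ} {x m y : X}
    (h : IsGeodesic c l x m) (h' : IsGeodesic c' l' m y) (hm : dist x m + dist m y = dist x y) :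
    IsGeodesic (fun s => if s ≤ l then c s else c' (s - l)) (l + l') x y := by
  have e := h.length_eq
  have e' := h'.length_eq
  have key : ∀ s s', 0 ≤ s → s ≤ s' → s' ≤ l + l' →
      dist (if s ≤ l then c s else c' (s - l)) (if s' ≤ l then c s' else c' (s' - l)) = s' - s := by
    intro s s' h0 h1 h2
    by_cases a : s' ≤ l
    · rw [if_pos (h1.trans a), if_pos a, h.2.2.2 s ⟨h0, h1.trans a⟩ s' ⟨h0.trans h1, a⟩,
        abs_sub_comm, abs_of_nonneg (by linarith)]
    · push Not at a
      rw [if_neg a.not_ge]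
      have hs' : s' - l ∈ Set.Icc 0 l' := ⟨by linarith, by linarith⟩
      by_cases b : s ≤ l
      · rw [if_pos b]
        have hs : s ∈ Set.Icc 0 l := ⟨h0, b⟩
        have d1 := h.dist_left hs
        have d2 := h.dist_right hs
        have d3 := h'.dist_left hs'
        have d4 := h'.dist_right hs'
        have t1 := dist_triangle (c s) m (c' (s' - l))
        have t2 := dist_triangle x (c s) (c' (s' - l))
        have t3 := dist_triangle x (c' (s' - l)) y
        linarith
      · push Not at b
        rw [if_neg b.not_ge, h'.2.2.2 _ ⟨by linarith, by linarith⟩ _ hs', abs_sub_comm,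
          abs_of_nonneg (by linarith)]
        ring
  refine ⟨add_nonneg h.1 h'.1, ?_, ?_, ?_⟩
  · simp only [h.1, if_true, h.2.1]
  · rcases h'.1.eq_or_lt with h0 | h0
    · beta_reduce
      rw [if_pos (by linarith), ← h0, add_zero, h.2.2.1]
      exact dist_eq_zero.1 (by linarith)
    · beta_reduce
      rw [if_neg (by linarith), add_sub_cancel_left, h'.2.2.1]
  · intro t ht t' ht'
    rcases le_total t t' with hle | hle
    · rw [key t t' ht.1 hle ht'.2, abs_sub_comm, abs_of_nonneg (by linarith)]
    · rw [dist_comm, key t' t ht'.1 hle ht.2, abs_of_nonneg (by linarith)]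

theorem dist_le_half {X : Type u} [MetricSpace X] {w p q m : X}
    (h : dist p m + dist m q = dist p q) :
    dist w m ≤ (dist w p + dist w q + dist p q) / 2 := by
  have := dist_triangle w p m
  have := dist_triangle w q m
  rw [dist_comm q m] at this
  linarith

/-- The CAT inequality compares `w` with `m`, and the comparison triangle satisfies the Stewart
identity. As `m` is only metrically between `p` and `q`, the side is concatenated from geodesics
through `m`. -/
theorem IsCAT.stewartIneq {κ : ℝ} {X : Type u} [MetricSpace X] (h : IsCAT κ X) :
    StewartIneq κ X := by
  obtain ⟨hg, hT⟩ := h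
  intro w p q m hm hper
  have t1 := dist_triangle w p q
  have t2 := dist_triangle w q p
  have t3 := dist_triangle p w q
  have n1 := dist_nonneg (x := p) (y := m)
  have n2 := dist_nonneg (x := m) (y := q)
  rw [dist_comm q p] at t2
  rw [dist_comm p w] at t3
  obtain ⟨c1, l1, g1⟩ := hg w p (fun hk => by linarith [hper hk])
  obtain ⟨c2, l2, g2⟩ := hg p m (fun hk => by linarith [hper hk])
  obtain ⟨c3, l3, g3⟩ := hg m q (fun hk => by linarith [hper hk])
  obtain ⟨c4, l4, g4⟩ := hg q w (fun hk => by rw [dist_comm q w]; linarith [hper hk])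
  have g5 := g2.concat g3 hm
  let T : GeodesicTriangle X := ⟨w, p, q, _, _, _, ⟨_, _, g1, rfl⟩, ⟨_, _, g5, rfl⟩, ⟨_, _, g4, rfl⟩⟩
  have hmT : m ∈ T.qr := by
    refine ⟨l2, ⟨g2.1, by linarith [g3.1]⟩, ?_⟩
    simp [g2.2.2.1]
  have hTper : 0 < κ → T.perimeter < 2 * (π / √κ) := by
    intro hk
    have := hper hk
    change dist w p + dist p q + dist q w < _
    rw [dist_comm q w]; linarith
  obtain ⟨T', e1, e2, e3⟩ := ModelPlane.exists_triangle (κ := κ) (a := dist w p) (b := dist w q)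
    (c := dist p q) dist_nonneg dist_nonneg dist_nonneg (by linarith) (by linarith) (by linarith)
    hper
  have hs : dist p m ∈ Set.Icc 0 (dist T'.q T'.r) := ⟨n1, by linarith⟩
  obtain ⟨m', hm', hm1⟩ := T'.isSegment_qr.exists_mem hs
  have hm2 := T'.isSegment_qr.dist_add hm'
  have e4 : dist m q = dist m' T'.r := by linarith
  have key := hT T hTper T' ⟨e1.symm, e2.symm, (dist_comm _ _).trans e3.symm⟩ w m T'.p m'
    (Or.inl ⟨T.isSegment_pq.left_mem, T'.isSegment_pq.left_mem,
      (dist_self _).trans (dist_self _).symm, e1.symm⟩)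
    (Or.inr (Or.inl ⟨hmT, hm', (dist_comm _ _).trans (hm1.symm.trans (dist_comm _ _)), e4⟩))
  have st := modelDist_stewart T'.q.2 m'.2 T'.r.2 T'.p.2 hm2
  have key2 : md κ (dist w m) ≤ md κ (dist T'.p m') :=
    md_le_md dist_nonneg key (modelDist_le _ _)
  rw [dist_comm] at e3
  change dist T'.q m' = _ at hm1
  have key3 : sn κ (dist p q) * md κ (dist w m) ≤ sn κ (dist p q) * md κ (dist T'.p m') :=
    mul_le_mul_of_nonneg_left key2 (sn_nonneg dist_nonneg (fun hk => by linarith [hper hk]))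
  refine key3.trans_eq ?_
  rw [← hm1, e4, ← e1, ← e2, ← e3]
  exact st

theorem ModelPlane.stewart {κ : ℝ} {p m q : ModelPlane κ} (w : ModelPlane κ)
    (h : dist p m + dist m q = dist p q) :
    sn κ (dist p q) * md κ (dist w m)
      = sn κ (dist m q) * md κ (dist w p) + sn κ (dist p m) * md κ (dist w q)
        + (sn κ (dist p q) * md κ (dist p m) - sn κ (dist p m) * md κ (dist p q)) :=
  modelDist_stewart p.2 m.2 q.2 w.2 h

/-- The Stewart bound is monotone in the distances from `w` to the endpoints. Hence inequalities
`f1`, `f2` suffice in place of equalities, and the result can be iterated. -/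
theorem StewartIneq.md_dist_le {κ : ℝ} {X : Type u} [MetricSpace X] (hX : StewartIneq κ X)
    {w p q m : X} {w' p' q' m' : ModelPlane κ} (hm : dist p m + dist m q = dist p q)
    (hper : 0 < κ → dist w p + dist w q + dist p q < 2 * (π / √κ))
    (e1 : dist p m = dist p' m') (e2 : dist m q = dist m' q') (e3 : dist p q = dist p' q')
    (f1 : md κ (dist w p) ≤ md κ (dist w' p')) (f2 : md κ (dist w q) ≤ md κ (dist w' q')) :
    md κ (dist w m) ≤ md κ (dist w' m') := by
  rcases (dist_nonneg (x := p) (y := q)).eq_or_lt with h0 | h0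
  · have n1 := dist_nonneg (x := p) (y := m)
    have n2 := dist_nonneg (x := m) (y := q)
    have a : p = m := dist_eq_zero.1 (by linarith)
    have b : p' = m' := dist_eq_zero.1 (by linarith)
    rw [← a, ← b]; exact f1
  · have t := dist_triangle p w q
    rw [dist_comm p w] at t
    have n1 := dist_nonneg (x := p) (y := m)
    have n2 := dist_nonneg (x := m) (y := q)
    have hlt : 0 < κ → dist p q < π / √κ := fun hk => by linarith [hper hk]
    have hpos := sn_pos h0 hlt
    have s1 := sn_nonneg n1 (fun hk => by linarith [hlt hk])
    have s2 := sn_nonneg n2 (fun hk => by linarith [hlt hk])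
    have k1 := hX w p q m hm hper
    have k2 := ModelPlane.stewart w' (p := p') (m := m') (q := q') (by rw [← e1, ← e2, ← e3, hm])
    rw [← e1, ← e2, ← e3] at k2
    refine le_of_mul_le_mul_left ?_ hpos
    linarith [mul_le_mul_of_nonneg_left f1 s2, mul_le_mul_of_nonneg_left f2 s1]

/-- Two Stewart comparisons: `r` with the point `x` of `pq`, then `x` with the point `y` of `pr`.
The second uses the bound on `dist r x` from the first, so no new comparison triangle is needed for
`x`, `p`, `r`. -/
theorem StewartIneq.dist_le_of_comparison {κ : ℝ} {X : Type u} [MetricSpace X]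
    (hX : StewartIneq κ X) {p q r x y : X} {p' q' r' x' y' : ModelPlane κ}
    (hper : 0 < κ → dist p q + dist q r + dist r p < 2 * (π / √κ))
    (d1 : dist p q = dist p' q') (d2 : dist q r = dist q' r') (d3 : dist r p = dist r' p')
    (hx : dist p x + dist x q = dist p q) (hy : dist p y + dist y r = dist p r)
    (x1 : dist p x = dist p' x') (x2 : dist x q = dist x' q')
    (y1 : dist p y = dist p' y') (y2 : dist y r = dist y' r') :
    dist x y ≤ dist x' y' := by
  have h1 : md κ (dist r x) ≤ md κ (dist r' x') :=
    hX.md_dist_le hx (fun hk => by rw [dist_comm r q]; linarith [hper hk]) x1 x2 d1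
      (by rw [d3]) (by rw [dist_comm r q, d2, dist_comm q' r'])
  have t := dist_triangle x q r
  have hper2 : 0 < κ → dist x p + dist x r + dist p r < 2 * (π / √κ) := fun hk => by
    rw [dist_comm x p, dist_comm p r]; linarith [hper hk]
  have h2 : md κ (dist x y) ≤ md κ (dist x' y') :=
    hX.md_dist_le hy hper2 y1 y2 (by rw [dist_comm p r, d3, dist_comm r' p'])
      (by rw [dist_comm x p, x1, dist_comm p' x'])
      (by rw [dist_comm x r, dist_comm x' r']; exact h1)
  exact le_of_md_le dist_nonneg (fun hk => by linarith [hper2 hk, dist_le_half (w := x) hy])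
    dist_nonneg h2

/-- Points on one side have equal distances in both triangles; two different sides share a vertex,
which takes the role of `p` in `StewartIneq.dist_le_of_comparison`. -/
theorem isCAT_of_stewartIneq {κ : ℝ} {X : Type u} [MetricSpace X]
    (hg : ∀ x y : X, (0 < κ → dist x y < π / √κ) → ∃ (c : ℝ → X) (l : ℝ), IsGeodesic c l x y)
    (hX : StewartIneq κ X) : IsCAT κ X := by
  refine ⟨hg, fun T hper T' hT' x y x' y' hx hy => ?_⟩
  obtain ⟨p, q, r, pq, qr, rp, i1, i2, i3⟩ := T
  obtain ⟨p', q', r', pq', qr', rp', j1, j2, j3⟩ := T'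
  simp only [GeodesicTriangle.perimeter, IsComparisonTriangle, IsComparisonPoint] at *
  obtain ⟨d1, d2, d3⟩ := hT'
  have d1' : dist q p = dist q' p' := by rw [dist_comm, d1, dist_comm]
  have d2' : dist r q = dist r' q' := by rw [dist_comm, d2, dist_comm]
  have d3' : dist p r = dist p' r' := by rw [dist_comm, d3, dist_comm]
  have add_symm : ∀ {S a b z}, IsGeodesicSegment (X := X) S a b → z ∈ S →
      dist b z + dist z a = dist b a := by
    intro S a b z h hz
    have := h.dist_add hz
    rw [dist_comm b z, dist_comm z a, dist_comm b a]; linarith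
  have hc : ∀ {z a : X} {z' a' : ModelPlane κ}, dist z a = dist z' a' → dist a z = dist a' z' := by
    intro z a z' a' h
    rw [dist_comm, h, dist_comm]
  rcases hx with ⟨h1, h1', h2, h3⟩ | ⟨h1, h1', h2, h3⟩ | ⟨h1, h1', h2, h3⟩ <;>
    rcases hy with ⟨k1, k1', k2, k3⟩ | ⟨k1, k1', k2, k3⟩ | ⟨k1, k1', k2, k3⟩
  · rw [i1.dist_eq h1 k1, j1.dist_eq h1' k1', hc h2, hc k2]
  · exact hX.dist_le_of_comparison (p := q) (q := p) (r := r) (p' := q') (q' := p') (r' := r')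
      (fun hk => by rw [dist_comm q p, dist_comm p r, dist_comm r q]; linarith [hper hk])
      d1' d3' d2' (add_symm i1 h1) (i2.dist_add k1) (hc h3) h2 (hc k2) k3
  · exact hX.dist_le_of_comparison hper d1 d2 d3 (i1.dist_add h1) (add_symm i3 k1) (hc h2) h3
      (hc k3) k2
  · exact hX.dist_le_of_comparison (p := q) (q := r) (r := p) (p' := q') (q' := r') (r' := p')
      (fun hk => by linarith [hper hk]) d2 d3 d1 (i2.dist_add h1) (add_symm i1 k1) (hc h2) h3
      (hc k3) k2
  · rw [i2.dist_eq h1 k1, j2.dist_eq h1' k1', hc h2, hc k2]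
  · exact hX.dist_le_of_comparison (p := r) (q := q) (r := p) (p' := r') (q' := q') (r' := p')
      (fun hk => by rw [dist_comm r q, dist_comm q p, dist_comm p r]; linarith [hper hk])
      d2' d1' d3' (add_symm i2 h1) (i3.dist_add k1) (hc h3) h2 (hc k2) k3
  · exact hX.dist_le_of_comparison (p := p) (q := r) (r := q) (p' := p') (q' := r') (r' := q')
      (fun hk => by rw [dist_comm p r, dist_comm r q, dist_comm q p]; linarith [hper hk])
      d3' d2' d1' (add_symm i3 h1) (i1.dist_add k1) (hc h3) h2 (hc k2) k3
  · exact hX.dist_le_of_comparison (p := r) (q := p) (r := q) (p' := r') (q' := p') (r' := q')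
      (fun hk => by linarith [hper hk]) d3 d1 d2 (i3.dist_add h1) (add_symm i2 k1) (hc h2) h3
      (hc k3) k2
  · rw [i3.dist_eq h1 k1, j3.dist_eq h1' k1', hc h2, hc k2]

/-! ### Planar geometry in polar coordinates -/

theorem le_of_mem_coneRadii {κ t : ℝ} (ht : t ∈ coneRadii κ) (hκ : 0 < κ) : t ≤ π / √κ := by
  have := ht.2 hκ
  have h0 : 0 < π / √κ := div_pos pi_pos (sqrt_pos.2 hκ)
  linarith

theorem sn_nonneg_of_mem {κ t : ℝ} (ht : t ∈ coneRadii κ) : 0 ≤ sn κ t :=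
  sn_nonneg ht.1 (le_of_mem_coneRadii ht)

theorem sn_pos_of_mem {κ t : ℝ} (ht : t ∈ coneRadii κ) (h0 : 0 < t) : 0 < sn κ t :=
  sn_pos h0 fun hκ => by
    have := ht.2 hκ
    have h0 : 0 < π / √κ := div_pos pi_pos (sqrt_pos.2 hκ)
    linarith

theorem coneLaw_neg (κ t t' θ : ℝ) : coneLaw κ t t' (-θ) = coneLaw κ t t' θ := by
  simp [coneLaw]

theorem coneLaw_abs (κ t t' θ : ℝ) : coneLaw κ t t' |θ| = coneLaw κ t t' θ := by
  simp [coneLaw]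

theorem coneLaw_zero_left_eq {κ t : ℝ} (ht : t ∈ coneRadii κ) (θ : ℝ) : coneLaw κ 0 t θ = t := by
  refine eq_of_md_eq (κ := κ) (coneLaw_nonneg le_rfl ht.1 _) (coneLaw_le _ _ _) ht.1
    (le_of_mem_coneRadii ht) ?_
  rw [md_coneLaw le_rfl ht.1]; simp

theorem coneLaw_zero_right_eq {κ t : ℝ} (ht : t ∈ coneRadii κ) (θ : ℝ) : coneLaw κ t 0 θ = t := by
  rw [coneLaw_comm, coneLaw_zero_left_eq ht]

theorem zero_mem_coneRadii (κ : ℝ) : (0 : ℝ) ∈ coneRadii κ :=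
  ⟨le_rfl, fun _ => div_nonneg (div_nonneg pi_pos.le (sqrt_nonneg _)) zero_le_two⟩

theorem coneLaw_le_add {κ t t' : ℝ} (ht : t ∈ coneRadii κ) (ht' : t' ∈ coneRadii κ) {θ : ℝ}
    (h0 : 0 ≤ θ) (hθ : θ ≤ π) : coneLaw κ t t' θ ≤ t + t' := by
  have := coneLaw_triangle ht (zero_mem_coneRadii κ) ht' h0 hθ pi_pos.le h0 hθ
    (add_zero θ).ge
  rwa [coneLaw_zero_right_eq ht, coneLaw_zero_left_eq ht'] at this

theorem angle_le_of_coneLaw_le {κ t t' : ℝ} (ht : t ∈ coneRadii κ) (ht' : t' ∈ coneRadii κ)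
    (h : 0 < t) (h' : 0 < t') {θ θ' : ℝ} (hθ : θ ≤ π) (hθ' : 0 ≤ θ')
    (hle : coneLaw κ t t' θ ≤ coneLaw κ t t' θ') : θ ≤ θ' := by
  have h1 := md_le_md (coneLaw_nonneg ht.1 ht'.1 _) hle (coneLaw_le _ _ _)
  rw [md_coneLaw ht.1 ht'.1, md_coneLaw ht.1 ht'.1] at h1
  have h2 : cos θ' ≤ cos θ := by
    refine le_of_mul_le_mul_left ?_ (mul_pos (sn_pos_of_mem ht h) (sn_pos_of_mem ht' h'))
    linarith
  by_contra hlt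
  push Not at hlt
  exact absurd (cos_lt_cos_of_nonneg_of_le_pi hθ' hθ hlt) (not_lt.2 h2)

theorem pi_le_of_coneLaw_eq_add {κ t t' : ℝ} (ht : t ∈ coneRadii κ) (ht' : t' ∈ coneRadii κ)
    (h : 0 < t) (h' : 0 < t') {θ : ℝ} (hθ : 0 ≤ θ) (he : coneLaw κ t t' θ = t + t') : π ≤ θ :=
  angle_le_of_coneLaw_le ht ht' h h' le_rfl hθ
    ((coneLaw_le_add ht ht' pi_pos.le le_rfl).trans_eq he.symm)

/-- Angles at the apex add up along a geodesic that avoids the apex. -/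
theorem angle_add_of_collinear {κ t₁ ρ t₂ : ℝ} (h₁ : t₁ ∈ coneRadii κ) (hρ : ρ ∈ coneRadii κ)
    (h₂ : t₂ ∈ coneRadii κ) (p₁ : 0 < t₁) (pρ : 0 < ρ) (p₂ : 0 < t₂) {φ ψ θ : ℝ}
    (φ0 : 0 ≤ φ) (φπ : φ ≤ π) (ψ0 : 0 ≤ ψ) (ψπ : ψ ≤ π) (θ0 : 0 ≤ θ) (θπ : θ ≤ π)
    (hle : θ ≤ φ + ψ) (h : coneLaw κ t₁ ρ φ + coneLaw κ ρ t₂ ψ = coneLaw κ t₁ t₂ θ) :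
    φ + ψ = θ := by
  -- The triangle inequality already holds with the smallest second angle compatible with `θ`. The
  -- equality `h` then forces `ψ` to be at most that angle; likewise for `φ`.
  have a := coneLaw_triangle h₁ hρ h₂ φ0 φπ (β := max 0 (θ - φ)) (max_le pi_pos.le (by linarith))
    θ0 θπ (by linarith [le_max_right 0 (θ - φ)])
  have b := coneLaw_triangle h₁ hρ h₂ (α := max 0 (θ - ψ)) (le_max_left _ _)
    (max_le pi_pos.le (by linarith)) ψπ θ0 θπ (by linarith [le_max_right 0 (θ - ψ)])
  have a' := angle_le_of_coneLaw_le hρ h₂ pρ p₂ ψπ (le_max_left 0 (θ - φ)) (by linarith)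
  have b' := angle_le_of_coneLaw_le h₁ hρ p₁ pρ φπ (le_max_left 0 (θ - ψ)) (by linarith)
  rcases max_choice 0 (θ - φ) with h1 | h1 <;> rcases max_choice 0 (θ - ψ) with h2 | h2 <;>
    rw [h1] at a' <;> rw [h2] at b' <;> linarith

/-- The factor is `√|κ|`, or `1` if `κ = 0`; it cancels from linear relations between coordinates,
which makes the three curvature cases uniform. -/
theorem modelPolar_coord (κ : ℝ) : ∃ k : ℝ, 0 < k ∧ ∀ t θ,
    modelPolar κ t θ 0 = k * (sn κ t * cos θ) ∧ modelPolar κ t θ 1 = k * (sn κ t * sin θ) := by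
  unfold modelPolar sn
  split_ifs with h h'
  · exact ⟨1, one_pos, fun t θ => by simp⟩
  · have := sqrt_pos.2 h'
    refine ⟨√κ, this, fun t θ => ?_⟩
    simp only [Matrix.cons_val_zero, Matrix.cons_val_one]
    constructor <;> field_simp
  · have : 0 < √(-κ) := sqrt_pos.2 (by rcases lt_or_gt_of_ne h with h | h <;> grind)
    refine ⟨√(-κ), this, fun t θ => ?_⟩
    simp only [Matrix.cons_val_zero, Matrix.cons_val_one]
    constructor <;> field_simp

section Collinear

variable {κ t₁ ρ t₂ φ ψ : ℝ}

/-- Second coordinate of `sn_mul_eq_of_collinear` with the first point on the axis `θ = 0`; the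
first coordinate is `collinear_cos`. -/
theorem collinear_sin (h : coneLaw κ t₁ ρ φ + coneLaw κ ρ t₂ ψ = coneLaw κ t₁ t₂ (φ + ψ)) :
    sn κ (coneLaw κ t₁ t₂ (φ + ψ)) * sn κ ρ * sin φ
      = sn κ (coneLaw κ t₁ ρ φ) * sn κ t₂ * sin (φ + ψ) := by
  obtain ⟨k, hk, hc⟩ := modelPolar_coord κ
  have d1 := modelDist_modelPolar κ t₁ ρ 0 φ
  have d2 := modelDist_modelPolar κ ρ t₂ φ (φ + ψ)
  have d3 := modelDist_modelPolar κ t₁ t₂ 0 (φ + ψ)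
  rw [zero_sub, coneLaw_neg] at d1 d3
  rw [sub_add_cancel_left, coneLaw_neg] at d2
  have := sn_mul_eq_of_collinear (modelPolar_mem κ t₁ 0) (modelPolar_mem κ ρ φ)
    (modelPolar_mem κ t₂ (φ + ψ)) (by rw [d1, d2, d3, h]) 1
  rw [d1, d2, d3, (hc _ _).2, (hc _ _).2, (hc _ _).2, sin_zero] at this
  apply mul_left_cancel₀ hk.ne'
  linear_combination this

theorem collinear_cos (h : coneLaw κ t₁ ρ φ + coneLaw κ ρ t₂ ψ = coneLaw κ t₁ t₂ (φ + ψ)) :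
    sn κ (coneLaw κ t₁ t₂ (φ + ψ)) * sn κ ρ * cos φ
      = sn κ (coneLaw κ ρ t₂ ψ) * sn κ t₁
        + sn κ (coneLaw κ t₁ ρ φ) * sn κ t₂ * cos (φ + ψ) := by
  obtain ⟨k, hk, hc⟩ := modelPolar_coord κ
  have d1 := modelDist_modelPolar κ t₁ ρ 0 φ
  have d2 := modelDist_modelPolar κ ρ t₂ φ (φ + ψ)
  have d3 := modelDist_modelPolar κ t₁ t₂ 0 (φ + ψ)
  rw [zero_sub, coneLaw_neg] at d1 d3
  rw [sub_add_cancel_left, coneLaw_neg] at d2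
  have := sn_mul_eq_of_collinear (modelPolar_mem κ t₁ 0) (modelPolar_mem κ ρ φ)
    (modelPolar_mem κ t₂ (φ + ψ)) (by rw [d1, d2, d3, h]) 0
  rw [d1, d2, d3, (hc _ _).1, (hc _ _).1, (hc _ _).1, cos_zero] at this
  apply mul_left_cancel₀ hk.ne'
  linear_combination this

theorem collinear_symm (h : coneLaw κ t₁ ρ φ + coneLaw κ ρ t₂ ψ = coneLaw κ t₁ t₂ (φ + ψ)) :
    coneLaw κ t₂ ρ ψ + coneLaw κ ρ t₁ φ = coneLaw κ t₂ t₁ (ψ + φ) := by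
  rw [coneLaw_comm κ t₂ ρ, coneLaw_comm κ ρ t₁, coneLaw_comm κ t₂ t₁, add_comm ψ, ← h, add_comm]

theorem collinear_sin_right
    (h : coneLaw κ t₁ ρ φ + coneLaw κ ρ t₂ ψ = coneLaw κ t₁ t₂ (φ + ψ)) :
    sn κ (coneLaw κ t₁ t₂ (φ + ψ)) * sn κ ρ * sin ψ
      = sn κ (coneLaw κ ρ t₂ ψ) * sn κ t₁ * sin (φ + ψ) := by
  have := collinear_sin (collinear_symm h)
  rwa [coneLaw_comm κ t₂ ρ, coneLaw_comm κ t₂ t₁, add_comm ψ] at this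

theorem collinear_cos_right
    (h : coneLaw κ t₁ ρ φ + coneLaw κ ρ t₂ ψ = coneLaw κ t₁ t₂ (φ + ψ)) :
    sn κ (coneLaw κ t₁ t₂ (φ + ψ)) * sn κ ρ * cos ψ
      = sn κ (coneLaw κ t₁ ρ φ) * sn κ t₂
        + sn κ (coneLaw κ ρ t₂ ψ) * sn κ t₁ * cos (φ + ψ) := by
  have := collinear_cos (collinear_symm h)
  rwa [coneLaw_comm κ t₂ ρ, coneLaw_comm κ t₂ t₁, add_comm ψ, coneLaw_comm κ ρ t₁] at this

/-- The Stewart identity seen from the pole of the polar coordinates. -/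
theorem collinear_radial (h₁ : t₁ ∈ coneRadii κ) (hρ : ρ ∈ coneRadii κ) (h₂ : t₂ ∈ coneRadii κ)
    (h : coneLaw κ t₁ ρ φ + coneLaw κ ρ t₂ ψ = coneLaw κ t₁ t₂ (φ + ψ)) :
    sn κ (coneLaw κ t₁ t₂ (φ + ψ)) * md κ ρ
      = sn κ (coneLaw κ ρ t₂ ψ) * md κ t₁ + sn κ (coneLaw κ t₁ ρ φ) * md κ t₂
        + (sn κ (coneLaw κ t₁ t₂ (φ + ψ)) * md κ (coneLaw κ t₁ ρ φ)
          - sn κ (coneLaw κ t₁ ρ φ) * md κ (coneLaw κ t₁ t₂ (φ + ψ))) := by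
  have d1 := modelDist_modelPolar κ t₁ ρ 0 φ
  have d2 := modelDist_modelPolar κ ρ t₂ φ (φ + ψ)
  have d3 := modelDist_modelPolar κ t₁ t₂ 0 (φ + ψ)
  rw [zero_sub, coneLaw_neg] at d1 d3
  rw [sub_add_cancel_left, coneLaw_neg] at d2
  have := modelDist_stewart (modelPolar_mem κ t₁ 0) (modelPolar_mem κ ρ φ)
    (modelPolar_mem κ t₂ (φ + ψ)) (modelPolar_mem κ 0 0) (by rw [d1, d2, d3, h])
  rw [d1, d2, d3] at this
  simp only [modelDist_modelPolar] at this
  rwa [coneLaw_zero_left_eq h₁, coneLaw_zero_left_eq hρ, coneLaw_zero_left_eq h₂] at this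

end Collinear

/-! ### Truncated distances -/

/-- The distance truncated at `π`. -/
noncomputable def tdist {Y : Type u} [MetricSpace Y] (y y' : Y) : ℝ := min π (dist y y')

section Tdist

variable {Y : Type u} [MetricSpace Y]

theorem tdist_nonneg (y y' : Y) : 0 ≤ tdist y y' := le_min pi_pos.le dist_nonneg

theorem tdist_le_pi (y y' : Y) : tdist y y' ≤ π := min_le_left _ _

theorem tdist_comm (y y' : Y) : tdist y y' = tdist y' y := by rw [tdist, dist_comm, tdist]

theorem tdist_self (y : Y) : tdist y y = 0 := by simp [tdist, pi_pos.le]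

theorem tdist_eq_of_lt {y y' : Y} (h : tdist y y' < π) : dist y y' = tdist y y' := by
  rcases min_choice π (dist y y') with h' | h'
  · exact absurd h' h.ne
  · exact h'.symm

theorem tdist_eq_dist {y y' : Y} (h : dist y y' ≤ π) : tdist y y' = dist y y' := min_eq_right h

theorem eq_of_tdist_eq_zero {y y' : Y} (h : tdist y y' = 0) : y = y' :=
  dist_eq_zero.1 ((tdist_eq_of_lt (h ▸ pi_pos)).trans h)

theorem tdist_triangle (x y z : Y) : tdist x z ≤ tdist x y + tdist y z := by
  have h := dist_triangle x y z
  have h1 := tdist_nonneg x y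
  have h2 := tdist_nonneg y z
  have h3 := tdist_le_pi x z
  rcases le_or_gt π (tdist x y) with h4 | h4
  · linarith
  · rcases le_or_gt π (tdist y z) with h5 | h5
    · linarith
    · rw [← tdist_eq_of_lt h4, ← tdist_eq_of_lt h5]
      exact (min_le_right _ _).trans h

end Tdist

/-- This replaces comparison when the perimeter is at least `2 * π`: the triangle inequalities alone
suffice. The extremal configuration is a great circle, where `b = 2 * π - (φ + ψ + a)` and the
trigonometric identity `e3` gives equality with `c = a + φ`. -/
theorem sin_mul_cos_add_le {a b c φ ψ : ℝ} (aπ : a ≤ π) (bπ : b ≤ π) (c0 : 0 ≤ c)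
    (φ0 : 0 ≤ φ) (ψ0 : 0 ≤ ψ) (hπ : φ + ψ < π) (ha : c ≤ a + φ)
    (hb : c ≤ b + ψ) (h : 2 * π ≤ a + b + (φ + ψ)) :
    sin ψ * cos a + sin φ * cos b ≤ sin (φ + ψ) * cos c := by
  have sφ : 0 ≤ sin φ := sin_nonneg_of_nonneg_of_le_pi φ0 (by linarith)
  have sψ : 0 ≤ sin ψ := sin_nonneg_of_nonneg_of_le_pi ψ0 (by linarith)
  have sθ : 0 ≤ sin (φ + ψ) := sin_nonneg_of_nonneg_of_le_pi (by linarith) hπ.le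
  by_cases h1 : a + φ ≤ π
  · have e1 := cos_le_cos_of_nonneg_of_le_pi c0 h1 ha
    have e2 := cos_le_cos_of_nonneg_of_le_pi (x := 2 * π - (φ + ψ + a)) (by linarith) bπ
      (by linarith)
    rw [cos_two_pi_sub] at e2
    have e3 : sin ψ * cos a + sin φ * cos (φ + ψ + a) = sin (φ + ψ) * cos (a + φ) := by
      rw [cos_add (φ + ψ), cos_add φ, cos_add a, sin_add]
      linear_combination (-sin ψ * cos a) * sin_sq_add_cos_sq φ
    linarith [mul_le_mul_of_nonneg_left e1 sθ, mul_le_mul_of_nonneg_left e2 sφ]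
  by_cases h2 : b + ψ ≤ π
  · have e1 := cos_le_cos_of_nonneg_of_le_pi c0 h2 hb
    have e2 := cos_le_cos_of_nonneg_of_le_pi (x := 2 * π - (φ + ψ + b)) (by linarith) aπ
      (by linarith)
    rw [cos_two_pi_sub] at e2
    have e3 : sin ψ * cos (φ + ψ + b) + sin φ * cos b = sin (φ + ψ) * cos (b + ψ) := by
      rw [cos_add (φ + ψ), cos_add φ, cos_add b, sin_add]
      linear_combination (-sin φ * cos b) * sin_sq_add_cos_sq ψ
    linarith [mul_le_mul_of_nonneg_left e1 sθ, mul_le_mul_of_nonneg_left e2 sψ]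
  -- Now `cos a ≤ -cos φ` and `cos b ≤ -cos ψ`, so the left side is at most `-sin (φ + ψ)`.
  · have e1 := cos_le_cos_of_nonneg_of_le_pi (x := π - φ) (by linarith) aπ (by linarith)
    have e2 := cos_le_cos_of_nonneg_of_le_pi (x := π - ψ) (by linarith) bπ (by linarith)
    rw [cos_pi_sub] at e1 e2
    have e3 := mul_nonneg sθ (by linarith [neg_one_le_cos c] : 0 ≤ 1 + cos c)
    have e4 := sin_add φ ψ
    linarith [mul_le_mul_of_nonneg_left e1 sψ, mul_le_mul_of_nonneg_left e2 sφ]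

theorem sn_one (x : ℝ) : sn 1 x = sin x := by simp [sn]

theorem md_one (x : ℝ) : md 1 x = 1 - cos x := by simp [md, cs]

/-- The spherical Stewart inequality, for truncated distances and without a bound on the
perimeter. -/
theorem StewartIneq.sin_mul_cos_tdist_le {Y : Type u} [MetricSpace Y] (hY : StewartIneq 1 Y)
    (w u v m : Y)
    (h : tdist u m + tdist m v = tdist u v) (hπ : tdist u v < π) :
    sin (tdist m v) * cos (tdist w u) + sin (tdist u m) * cos (tdist w v)
      ≤ sin (tdist u v) * cos (tdist w m) := by
  have n1 := tdist_nonneg u m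
  have n2 := tdist_nonneg m v
  by_cases hper : 2 * π ≤ tdist w u + tdist w v + tdist u v
  · rw [← h] at hπ hper ⊢
    refine sin_mul_cos_add_le (tdist_le_pi _ _) (tdist_le_pi _ _) (tdist_nonneg _ _)
      n1 n2 hπ (tdist_triangle _ _ _) ?_ hper
    rw [tdist_comm m v]
    exact tdist_triangle _ _ _
  -- Below perimeter `2 * π` the truncation is inactive: each side is shorter than half the
  -- perimeter, and so is the distance from `w` to `m`.
  · push Not at hper
    have t1 := tdist_triangle w v u
    have t2 := tdist_triangle w u v
    have p1 := tdist_le_pi w u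
    have p2 := tdist_le_pi w v
    rw [tdist_comm v u] at t1
    have e0 := tdist_eq_of_lt hπ
    have e1 := tdist_eq_of_lt (y := u) (y' := m) (by linarith)
    have e2 := tdist_eq_of_lt (y := m) (y' := v) (by linarith)
    have e3 := tdist_eq_of_lt (y := w) (y' := u) (by linarith)
    have e4 := tdist_eq_of_lt (y := w) (y' := v) (by linarith)
    have hd : dist u m + dist m v = dist u v := by rw [e0, e1, e2, h]
    have e5 := tdist_eq_dist (y := w) (y' := m) (by
      have := dist_le_half (w := w) hd
      linarith)
    have k := hY w u v m hd (fun _ => by rw [sqrt_one, div_one]; linarith)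
    simp only [sn_one, md_one] at k
    rw [← e0, ← e1, ← e2, ← e3, ← e4, e5]
    have s := sin_sub (dist u v) (dist u m)
    rw [show dist u v - dist u m = dist m v by linarith] at s
    linarith

/-! ### The Stewart inequality in the cone -/

/-- The point of the cone with radius `t` in the direction `y`. -/
def KCone.mk {κ : ℝ} {Y : Type u} (t : coneRadii κ) (y : Y) : KCone κ Y := Quotient.mk _ (t, y)

theorem KCone.exists_mk {κ : ℝ} {Y : Type u} (x : KCone κ Y) :
    ∃ t y, x = KCone.mk (κ := κ) (Y := Y) t y := by
  induction x using Quotient.inductionOn with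
  | h a => exact ⟨a.1, a.2, rfl⟩

section Cone

variable {κ : ℝ} {Y : Type u} [MetricSpace Y]

theorem KCone.dist_mk (t t' : coneRadii κ) (y y' : Y) :
    dist (KCone.mk t y) (KCone.mk t' y') = coneLaw κ t t' (tdist y y') := rfl

/-- The defect in the Stewart inequality of the cone, for a point `m` of radius `ρ` between points
of radii `t₁` and `t₂`; the angles at the apex enter through their cosines. -/
theorem stewart_defect {t t₁ t₂ ρ θ s r a b c : ℝ} (ht : 0 ≤ t) (ht₁ : 0 ≤ t₁) (ht₂ : 0 ≤ t₂)
    (hρ : 0 ≤ ρ) (hs : s + r = coneLaw κ t₁ t₂ θ)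
    (hrad : sn κ (coneLaw κ t₁ t₂ θ) * md κ ρ = sn κ r * md κ t₁ + sn κ s * md κ t₂
      + (sn κ (coneLaw κ t₁ t₂ θ) * md κ s - sn κ s * md κ (coneLaw κ t₁ t₂ θ))) :
    sn κ r * md κ (coneLaw κ t t₁ a) + sn κ s * md κ (coneLaw κ t t₂ b)
        + (sn κ (coneLaw κ t₁ t₂ θ) * md κ s - sn κ s * md κ (coneLaw κ t₁ t₂ θ))
        - sn κ (coneLaw κ t₁ t₂ θ) * md κ (coneLaw κ t ρ c)
      = sn κ t * (sn κ (coneLaw κ t₁ t₂ θ) * sn κ ρ * cos c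
        - (sn κ r * sn κ t₁ * cos a + sn κ s * sn κ t₂ * cos b)) := by
  rw [md_coneLaw ht ht₁, md_coneLaw ht ht₂, md_coneLaw ht hρ]
  -- With `r = l - s`, this formula and `hrad` weighted by `cs κ t` cancel all terms without `cos
  -- a`, `cos b` or `cos c`.
  have g2 := sn_sub κ (coneLaw κ t₁ t₂ θ) s
  rw [← hs, add_sub_cancel_left, hs] at g2
  simp only [cs_eq_one_sub] at g2
  linear_combination (κ * md κ t - 1) * hrad + md κ t * g2

/-- A segment starting at the apex is radial, so `ψ = 0` and equality holds. -/
theorem cone_cos_le_of_radius_eq_zero {t₁ ρ t₂ a c b ψ l : ℝ} (h₁ : t₁ = 0)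
    (hρ : ρ ∈ coneRadii κ) (h₂ : t₂ ∈ coneRadii κ) (pρ : 0 < ρ) (ψ0 : 0 ≤ ψ) (ψπ : ψ ≤ π)
    (hl : l = t₂) (h : ρ + coneLaw κ ρ t₂ ψ = t₂) (hbc : ψ = 0 → c = b) :
    sn κ (coneLaw κ ρ t₂ ψ) * sn κ t₁ * cos a + sn κ ρ * sn κ t₂ * cos b
      ≤ sn κ l * sn κ ρ * cos c := by
  subst h₁ hl
  have p₂ : 0 < l := by linarith [coneLaw_nonneg (κ := κ) hρ.1 h₂.1 ψ]
  have z : coneLaw κ 0 ρ 0 + coneLaw κ ρ l ψ = coneLaw κ 0 l (0 + ψ) := by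
    rw [coneLaw_zero_left_eq hρ, coneLaw_zero_left_eq h₂, h]
  have k := collinear_cos_right z
  rw [coneLaw_zero_left_eq hρ, coneLaw_zero_left_eq h₂, sn_zero] at k
  have hc : cos ψ = 1 := by
    have := mul_pos (sn_pos_of_mem h₂ p₂) (sn_pos_of_mem hρ pρ)
    apply mul_left_cancel₀ this.ne'
    linarith
  have hψ := (cos_eq_one_iff_of_lt_of_lt (by linarith [pi_pos]) (by linarith [pi_pos])).1 hc
  rw [hbc hψ, sn_zero]
  linarith

/-- Nonnegativity of the bracket in `stewart_defect`. For positive radii and `0 < θ < π`, with `θ =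
tdist u v`, multiplication by `sin θ` and the sine relations reduce it to the spherical Stewart
inequality. -/
theorem cone_cos_le (hY : StewartIneq 1 Y) {t₁ ρ t₂ : ℝ} (h₁ : t₁ ∈ coneRadii κ)
    (hρ : ρ ∈ coneRadii κ) (h₂ : t₂ ∈ coneRadii κ) (w u v m : Y)
    (h : coneLaw κ t₁ ρ (tdist u m) + coneLaw κ ρ t₂ (tdist m v) = coneLaw κ t₁ t₂ (tdist u v))
    (hD : 0 < κ → coneLaw κ t₁ t₂ (tdist u v) < π / √κ) :
    sn κ (coneLaw κ ρ t₂ (tdist m v)) * sn κ t₁ * cos (tdist w u)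
        + sn κ (coneLaw κ t₁ ρ (tdist u m)) * sn κ t₂ * cos (tdist w v)
      ≤ sn κ (coneLaw κ t₁ t₂ (tdist u v)) * sn κ ρ * cos (tdist w m) := by
  have l0 := coneLaw_nonneg (κ := κ) h₁.1 h₂.1 (tdist u v)
  have s0 := coneLaw_nonneg (κ := κ) h₁.1 hρ.1 (tdist u m)
  have r0 := coneLaw_nonneg (κ := κ) hρ.1 h₂.1 (tdist m v)
  have sl := sn_nonneg (κ := κ) l0 (fun hk => (hD hk).le)
  have ss := sn_nonneg (κ := κ) s0 (fun hk => by linarith [hD hk])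
  have sr := sn_nonneg (κ := κ) r0 (fun hk => by linarith [hD hk])
  have st1 := sn_nonneg_of_mem h₁
  have st2 := sn_nonneg_of_mem h₂
  have sρ := sn_nonneg_of_mem hρ
  -- For antipodal directions the angles from `w` sum to at least `π`.
  have hcos : tdist u v = π → cos (tdist w u) + cos (tdist w v) ≤ 0 := by
    intro hπ
    have := tdist_triangle u w v
    rw [hπ, tdist_comm u w] at this
    have := cos_le_cos_of_nonneg_of_le_pi (x := π - tdist w u) (by linarith [tdist_le_pi w u])
      (tdist_le_pi w v) (by linarith)
    rw [cos_pi_sub] at this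
    linarith
  rcases hρ.1.eq_or_lt with rfl | pρ
  · rw [coneLaw_zero_left_eq h₂, coneLaw_zero_right_eq h₁] at h ⊢
    simp only [sn_zero, mul_zero, zero_mul]
    rcases h₁.1.eq_or_lt with rfl | p₁
    · simp
    rcases h₂.1.eq_or_lt with rfl | p₂
    · simp
    have hπ := pi_le_of_coneLaw_eq_add h₁ h₂ p₁ p₂ (tdist_nonneg u v) h.symm
    have := mul_nonneg (mul_nonneg st1 st2)
      (neg_nonneg.2 (hcos (le_antisymm (tdist_le_pi _ _) hπ)))
    linarith
  rcases h₁.1.eq_or_lt with h1' | p₁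
  · rw [← h1', coneLaw_zero_left_eq hρ, coneLaw_zero_left_eq h₂] at h ⊢
    exact cone_cos_le_of_radius_eq_zero rfl hρ h₂ pρ (tdist_nonneg _ _) (tdist_le_pi _ _) rfl h
      (fun h0 => by rw [eq_of_tdist_eq_zero h0])
  rcases h₂.1.eq_or_lt with h2' | p₂
  · rw [← h2', coneLaw_zero_right_eq hρ, coneLaw_zero_right_eq h₁] at h ⊢
    have := cone_cos_le_of_radius_eq_zero (κ := κ) (t₁ := 0) (a := tdist w v) (c := tdist w m)
      (b := tdist w u) rfl hρ h₁ pρ (tdist_nonneg u m) (tdist_le_pi _ _) rfl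
      (by rw [coneLaw_comm, add_comm, h]) (fun h0 => by rw [eq_of_tdist_eq_zero h0])
    rw [coneLaw_comm κ t₁ ρ, add_comm]
    exact this
  have hadd := angle_add_of_collinear h₁ hρ h₂ p₁ pρ p₂ (tdist_nonneg u m) (tdist_le_pi _ _)
    (tdist_nonneg m v) (tdist_le_pi _ _) (tdist_nonneg u v) (tdist_le_pi _ _)
    (tdist_triangle _ _ _) h
  have h' := h
  rw [← hadd] at h'
  have i1 := collinear_sin h'
  have i2 := collinear_sin_right h'
  have i3 := collinear_cos h'
  have i4 := collinear_cos_right h'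
  rw [hadd] at i1 i2 i3 i4
  have n1 := tdist_nonneg u m
  have n2 := tdist_nonneg m v
  rcases (tdist_le_pi u v).lt_or_eq with hπ | hπ
  · rcases (tdist_nonneg u v).eq_or_lt with hθ | hθ
    · have e1 := eq_of_tdist_eq_zero (y := u) (y' := m) (by linarith)
      have e2 := eq_of_tdist_eq_zero (y := m) (y' := v) (by linarith)
      subst e1 e2
      rw [tdist_self, cos_zero] at i3
      rw [tdist_self]
      refine le_of_eq ?_
      linear_combination (-cos (tdist w u)) * i3
    · have k := hY.sin_mul_cos_tdist_le w u v m hadd hπ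
      have sθ : 0 < sin (tdist u v) := sin_pos_of_pos_of_lt_pi hθ hπ
      refine le_of_mul_le_mul_left ?_ sθ
      have := mul_le_mul_of_nonneg_left k (mul_nonneg sl sρ)
      refine le_trans (le_of_eq ?_) (this.trans_eq (by ring))
      linear_combination (-cos (tdist w u)) * i2 - cos (tdist w v) * i1
  · rcases l0.eq_or_lt with l0' | l0'
    · rw [← l0'] at h
      rw [← l0', le_antisymm (by linarith) s0, le_antisymm (by linarith) r0]
      simp
    · have hpos : 0 < sn κ (coneLaw κ t₁ t₂ (tdist u v)) * sn κ ρ :=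
        mul_pos (sn_pos l0' hD) (sn_pos_of_mem hρ pρ)
      rw [hπ, sin_pi, mul_zero, ← hπ] at i1
      -- A segment through the apex consists of two rays, so `m` has the direction `u` or `v`.
      have hsin : sin (tdist u m) = 0 := (mul_eq_zero.1 i1).resolve_left hpos.ne'
      rcases (tdist_le_pi u m).lt_or_eq with hm | hm
      · have hφ := (sin_eq_zero_iff_of_lt_of_lt (by linarith [pi_pos]) hm).1 hsin
        have e1 := eq_of_tdist_eq_zero hφ
        subst e1
        rw [tdist_self, cos_zero, hπ, cos_pi, ← hπ] at i3
        have := mul_nonneg (mul_nonneg ss st2) (neg_nonneg.2 (hcos hπ))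
        rw [tdist_self] at this ⊢
        rw [mul_one] at i3
        rw [i3]
        linarith
      · have e2 := eq_of_tdist_eq_zero (y := m) (y' := v) (by linarith)
        subst e2
        rw [tdist_self, cos_zero, hπ, cos_pi, ← hπ] at i4
        have := mul_nonneg (mul_nonneg sr st1) (neg_nonneg.2 (hcos hπ))
        rw [tdist_self] at this ⊢
        rw [mul_one] at i4
        rw [i4]
        linarith

/-- The configuration is realised in the plane by angles that add up exactly. If a radius vanishes,
the angles at it are immaterial and are chosen anew to fit; otherwise the given angles add up. -/
theorem cone_radial {t₁ ρ t₂ : ℝ} (h₁ : t₁ ∈ coneRadii κ)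
    (hρ : ρ ∈ coneRadii κ) (h₂ : t₂ ∈ coneRadii κ) (u v m : Y)
    (h : coneLaw κ t₁ ρ (tdist u m) + coneLaw κ ρ t₂ (tdist m v) = coneLaw κ t₁ t₂ (tdist u v)) :
    sn κ (coneLaw κ t₁ t₂ (tdist u v)) * md κ ρ
      = sn κ (coneLaw κ ρ t₂ (tdist m v)) * md κ t₁ + sn κ (coneLaw κ t₁ ρ (tdist u m)) * md κ t₂
        + (sn κ (coneLaw κ t₁ t₂ (tdist u v)) * md κ (coneLaw κ t₁ ρ (tdist u m))
          - sn κ (coneLaw κ t₁ ρ (tdist u m)) * md κ (coneLaw κ t₁ t₂ (tdist u v))) := by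
  obtain ⟨φ, ψ, e1, e2, e3⟩ : ∃ φ ψ, coneLaw κ t₁ ρ φ = coneLaw κ t₁ ρ (tdist u m) ∧
      coneLaw κ ρ t₂ ψ = coneLaw κ ρ t₂ (tdist m v) ∧
      coneLaw κ t₁ t₂ (φ + ψ) = coneLaw κ t₁ t₂ (tdist u v) := by
    rcases hρ.1.eq_or_lt with rfl | pρ
    · exact ⟨tdist u v, 0, by rw [coneLaw_comm, coneLaw_zero_left κ t₁ _ (tdist u m), coneLaw_comm],
        coneLaw_zero_left _ _ _ _, by rw [add_zero]⟩
    rcases h₁.1.eq_or_lt with rfl | p₁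
    · exact ⟨0, tdist m v, coneLaw_zero_left _ _ _ _, rfl, coneLaw_zero_left _ _ _ _⟩
    rcases h₂.1.eq_or_lt with rfl | p₂
    · refine ⟨tdist u m, 0, rfl, ?_, ?_⟩
      · rw [coneLaw_comm, coneLaw_zero_left κ ρ _ (tdist m v), coneLaw_comm]
      · rw [coneLaw_comm, coneLaw_zero_left κ t₁ _ (tdist u v), coneLaw_comm]
    have hadd := angle_add_of_collinear h₁ hρ h₂ p₁ pρ p₂ (tdist_nonneg u m) (tdist_le_pi _ _)
      (tdist_nonneg m v) (tdist_le_pi _ _) (tdist_nonneg u v) (tdist_le_pi _ _)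
      (tdist_triangle _ _ _) h
    exact ⟨_, _, rfl, rfl, by rw [hadd]⟩
  have := collinear_radial h₁ hρ h₂ (by rw [e1, e2, e3, h])
  rwa [e1, e2, e3] at this

theorem StewartIneq.cone (hY : StewartIneq 1 Y) : StewartIneq κ (KCone κ Y) := by
  intro W U V M
  obtain ⟨t, w, rfl⟩ := W.exists_mk
  obtain ⟨t₁, u, rfl⟩ := U.exists_mk
  obtain ⟨t₂, v, rfl⟩ := V.exists_mk
  obtain ⟨ρ, m, rfl⟩ := M.exists_mk
  intro h hper
  have hD : 0 < κ → dist (KCone.mk t₁ u) (KCone.mk t₂ v) < π / √κ := by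
    intro hk
    have := dist_triangle (KCone.mk t₁ u) (KCone.mk t w) (KCone.mk t₂ v)
    rw [dist_comm (KCone.mk t₁ u) (KCone.mk t w)] at this
    linarith [hper hk]
  simp only [KCone.dist_mk] at *
  have k := cone_cos_le hY t₁.2 ρ.2 t₂.2 w u v m h hD
  have e := stewart_defect (κ := κ) (a := tdist w u) (b := tdist w v) (c := tdist w m)
    t.2.1 t₁.2.1 t₂.2.1 ρ.2.1 h (cone_radial t₁.2 ρ.2 t₂.2 u v m h)
  have := mul_nonneg (sn_nonneg_of_mem t.2) (sub_nonneg.2 k)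
  linarith

end Cone

/-! ### Geodesics in the cone -/

/-- The angle is the argument of the first two coordinates and their norm determines the radius. For
`κ > 0` the cone radii cover only the closed hemisphere, hence `h2`. -/
theorem exists_modelPolar_eq {κ : ℝ} {v : EuclideanSpace ℝ (Fin 3)} (hv : v ∈ modelCarrier κ)
    (h2 : 0 < κ → 0 ≤ v 2) : ∃ ρ ∈ coneRadii κ, ∃ φ ∈ Set.Ioc (-π) π, modelPolar κ ρ φ = v := by
  set z : ℂ := ⟨v 0, v 1⟩ with hz
  have hn : ‖z‖ ^ 2 = v 0 ^ 2 + v 1 ^ 2 := by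
    rw [Complex.sq_norm, Complex.normSq_apply]; simp [hz]; ring
  have hc : ‖z‖ * cos z.arg = v 0 := Complex.norm_mul_cos_arg z
  have hs : ‖z‖ * sin z.arg = v 1 := Complex.norm_mul_sin_arg z
  have hn0 := norm_nonneg z
  rcases lt_trichotomy κ 0 with h | h | h
  · have hsq : 0 < √(-κ) := sqrt_pos.2 (by linarith)
    refine ⟨arsinh ‖z‖ / √(-κ), ⟨div_nonneg (arsinh_nonneg_iff.2 hn0) hsq.le,
      fun h' => absurd h h'.not_gt⟩, z.arg, Complex.arg_mem_Ioc z, ?_⟩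
    have h3 : √(1 + ‖z‖ ^ 2) = v 2 := by
      rw [hn, show 1 + (v 0 ^ 2 + v 1 ^ 2) = v 2 ^ 2 by linarith [(hv.2.2 h).1],
        sqrt_sq (hv.2.2 h).2.le]
    rw [modelPolar, if_neg h.ne, if_neg h.not_gt, mul_div_cancel₀ _ hsq.ne', sinh_arsinh,
      cosh_arsinh, hc, hs, h3]
    ext i; fin_cases i <;> rfl
  · subst h
    refine ⟨‖z‖, ⟨hn0, fun h => absurd h (lt_irrefl _)⟩, z.arg, Complex.arg_mem_Ioc z, ?_⟩
    rw [modelPolar, if_pos rfl, hc, hs, ← hv.1 rfl]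
    ext i; fin_cases i <;> rfl
  · have hsq : 0 < √κ := sqrt_pos.2 h
    have h1 := hv.2.1 h
    have hle : ‖z‖ ≤ 1 := by
      rw [← sq_le_one_iff₀ hn0, hn]; linarith [sq_nonneg (v 2)]
    refine ⟨arcsin ‖z‖ / √κ, ⟨div_nonneg (arcsin_nonneg.2 hn0) hsq.le, fun _ => ?_⟩,
      z.arg, Complex.arg_mem_Ioc z, ?_⟩
    · rw [div_right_comm]
      exact div_le_div_of_nonneg_right (arcsin_le_pi_div_two _) hsq.le
    · have h3 : √(1 - ‖z‖ ^ 2) = v 2 := by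
        rw [hn, show 1 - (v 0 ^ 2 + v 1 ^ 2) = v 2 ^ 2 by linarith, sqrt_sq (h2 h)]
      rw [modelPolar, if_neg h.ne', if_pos h, mul_div_cancel₀ _ hsq.ne',
        sin_arcsin (by linarith) hle, cos_arcsin, hc, hs, h3]
      ext i; fin_cases i <;> rfl

theorem modelPolar_two_nonneg {κ t : ℝ} (ht : t ∈ coneRadii κ) (θ : ℝ) (hκ : 0 < κ) :
    0 ≤ modelPolar κ t θ 2 := by
  obtain ⟨a, b⟩ := sin_sqrt_mul_nonneg hκ ht
  simp only [modelPolar, hκ.ne', hκ, if_true, if_false]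
  exact cos_nonneg_of_mem_Icc ⟨by linarith [pi_pos], b⟩

/-- Polar coordinates on a planar segment. -/
theorem exists_modelPolar_eq_modelSeg {κ t₁ t₂ θ s : ℝ} (h₁ : t₁ ∈ coneRadii κ)
    (h₂ : t₂ ∈ coneRadii κ) (θ0 : 0 ≤ θ) (θπ : θ ≤ π)
    (l0 : 0 < coneLaw κ t₁ t₂ θ) (hD : 0 < κ → coneLaw κ t₁ t₂ θ < π / √κ)
    (hs : s ∈ Set.Icc 0 (coneLaw κ t₁ t₂ θ)) :
    ∃ ρ ∈ coneRadii κ, ∃ φ ∈ Set.Icc 0 θ, (θ = π → φ = 0 ∨ φ = π) ∧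
      modelPolar κ ρ φ
        = modelSeg κ (coneLaw κ t₁ t₂ θ) (modelPolar κ t₁ 0) (modelPolar κ t₂ θ) s := by
  have d : modelDist κ (modelPolar κ t₁ 0) (modelPolar κ t₂ θ) = coneLaw κ t₁ t₂ θ := by
    rw [modelDist_modelPolar, zero_sub, coneLaw_neg]
  have hpos := sn_pos l0 hD
  have hmem := modelSeg_mem (modelPolar_mem κ t₁ 0) (modelPolar_mem κ t₂ θ) (by rwa [d])
    (by rwa [d]) (by rwa [d])
  rw [d] at hmem
  have a0 : 0 ≤ sn κ (coneLaw κ t₁ t₂ θ - s) := sn_nonneg (by linarith [hs.2])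
    (fun hk => by linarith [hs.1, hD hk])
  have b0 : 0 ≤ sn κ s := sn_nonneg hs.1 (fun hk => by linarith [hs.2, hD hk])
  have st1 := sn_nonneg_of_mem h₁
  have st2 := sn_nonneg_of_mem h₂
  obtain ⟨ρ, hρ, φ, hφ, e⟩ := exists_modelPolar_eq hmem (fun hk => by
    have := modelPolar_two_nonneg h₁ 0 hk
    have := modelPolar_two_nonneg h₂ θ hk
    rw [modelSeg_apply]; positivity)
  rcases hρ.1.eq_or_lt with h0 | h0
  -- At the pole the angle is free.
  · refine ⟨ρ, hρ, 0, ⟨le_rfl, θ0⟩, fun _ => Or.inl rfl, ?_⟩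
    rw [← e, ← h0]
    simp [modelPolar]
  refine ⟨ρ, hρ, φ, ?_, ?_, e⟩
  all_goals
    obtain ⟨k, hk, hc⟩ := modelPolar_coord κ
    have x := congrArg (fun v : EuclideanSpace ℝ (Fin 3) => v 0) e
    have y := congrArg (fun v : EuclideanSpace ℝ (Fin 3) => v 1) e
    simp only [modelSeg_apply, (hc _ _).1, (hc _ _).2, cos_zero, sin_zero] at x y
    field_simp at x y
    simp only [mul_zero, zero_add] at y
    have hP : 0 < sn κ (coneLaw κ t₁ t₂ θ) * sn κ ρ := mul_pos hpos (sn_pos_of_mem hρ h0)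
    have sθ := sin_nonneg_of_nonneg_of_le_pi θ0 θπ
    have y0 : 0 ≤ sin φ := by
      refine nonneg_of_mul_nonneg_right (b := sin φ) ?_ hP
      have : 0 ≤ sn κ s * sn κ t₂ * sin θ := by positivity
      linarith
    have φ0 : 0 ≤ φ := by
      by_contra hneg
      push Not at hneg
      exact absurd (sin_neg_of_neg_of_neg_pi_lt hneg hφ.1) (not_lt.2 y0)
  · refine ⟨φ0, ?_⟩
    by_contra hlt
    push Not at hlt
    rcases θ0.eq_or_lt with hθ0 | hθ0
    · have e1 : sin θ = 0 := by rw [← hθ0, sin_zero]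
      have e2 : cos θ = 1 := by rw [← hθ0, cos_zero]
      rw [e1, mul_zero] at y
      rw [e2, mul_one] at x
      have hsin : sin φ = 0 := by
        apply mul_left_cancel₀ hP.ne'
        linarith
      have hcos : 0 ≤ cos φ := by
        refine nonneg_of_mul_nonneg_right (b := cos φ) ?_ hP
        have : 0 ≤ sn κ (coneLaw κ t₁ t₂ θ - s) * sn κ t₁ + sn κ s * sn κ t₂ := by positivity
        linarith
      rcases hφ.2.lt_or_eq with h | h
      · linarith [(sin_eq_zero_iff_of_lt_of_lt (by linarith) h).1 hsin]
      · rw [h, cos_pi] at hcos; linarith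
    -- Eliminating the `t₂` terms from `x` and `y` makes a positive multiple of `sin (φ - θ)` equal
    -- to `-(sn (l - s) * sn t₁ * sin θ)`.
    · have : sin (φ - θ) ≤ 0 := by
        by_contra hpos'
        push Not at hpos'
        have h1 := mul_pos hP hpos'
        rw [sin_sub] at h1
        have : 0 ≤ sn κ (coneLaw κ t₁ t₂ θ - s) * sn κ t₁ * sin θ := by positivity
        have h2 : sn κ (coneLaw κ t₁ t₂ θ) * sn κ ρ * (sin φ * cos θ - cos φ * sin θ)
            = -(sn κ (coneLaw κ t₁ t₂ θ - s) * sn κ t₁ * sin θ) := by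
          linear_combination cos θ * y - sin θ * x
        linarith
      exact absurd (sin_pos_of_pos_of_lt_pi (by linarith) (by linarith [hφ.2])) (not_lt.2 this)
  · intro hθπ
    rw [hθπ, sin_pi, mul_zero, ← hθπ] at y
    have hsin : sin φ = 0 := by
      apply mul_left_cancel₀ hP.ne'
      linarith
    rcases hφ.2.lt_or_eq with h | h
    · exact Or.inl ((sin_eq_zero_iff_of_lt_of_lt (by linarith [pi_pos]) h).1 hsin)
    · exact Or.inr h

/-- If `c` preserves angles, `(ρ, φ) ↦ KCone.mk ρ (c φ)` preserves distances and maps a planar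
segment to a geodesic. For `θ = π` the segment meets only the angles `0` and `π`, so `c` need not be
a path; this serves directions with no geodesic between them. -/
theorem KCone.exists_isGeodesic_of_lift {κ : ℝ} {Y : Type u} [MetricSpace Y] (t₁ t₂ : coneRadii κ)
    {θ : ℝ} (θ0 : 0 ≤ θ) (θπ : θ ≤ π) (c : ℝ → Y)
    (hc : ∀ φ ∈ Set.Icc 0 θ, (θ = π → φ = 0 ∨ φ = π) → ∀ φ' ∈ Set.Icc 0 θ,
      (θ = π → φ' = 0 ∨ φ' = π) → tdist (c φ) (c φ') = |φ - φ'|)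
    (l0 : 0 < coneLaw κ t₁ t₂ θ) (hD : 0 < κ → coneLaw κ t₁ t₂ θ < π / √κ) :
    ∃ (γ : ℝ → KCone κ Y) (l : ℝ), IsGeodesic γ l (KCone.mk t₁ (c 0)) (KCone.mk t₂ (c θ)) := by
  have d : modelDist κ (modelPolar κ t₁ 0) (modelPolar κ t₂ θ) = coneLaw κ t₁ t₂ θ := by
    rw [modelDist_modelPolar, zero_sub, coneLaw_neg]
  have hpos := sn_pos l0 hD
  have key : ∀ s, ∃ (ρ : coneRadii κ) (φ : ℝ), s ∈ Set.Icc 0 (coneLaw κ t₁ t₂ θ) →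
      φ ∈ Set.Icc 0 θ ∧ (θ = π → φ = 0 ∨ φ = π) ∧ modelPolar κ ρ φ
        = modelSeg κ (coneLaw κ t₁ t₂ θ) (modelPolar κ t₁ 0) (modelPolar κ t₂ θ) s := by
    intro s
    by_cases hs : s ∈ Set.Icc 0 (coneLaw κ t₁ t₂ θ)
    · obtain ⟨ρ, hρ, φ, h⟩ := exists_modelPolar_eq_modelSeg t₁.2 t₂.2 θ0 θπ l0 hD hs
      exact ⟨⟨ρ, hρ⟩, φ, fun _ => h⟩
    · exact ⟨t₁, 0, fun h => absurd h hs⟩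
  choose ρ φ h using key
  have hdist : ∀ (r r' : coneRadii κ) (α β : ℝ), α ∈ Set.Icc 0 θ → (θ = π → α = 0 ∨ α = π) →
      β ∈ Set.Icc 0 θ → (θ = π → β = 0 ∨ β = π) →
      dist (KCone.mk r (c α)) (KCone.mk r' (c β))
        = modelDist κ (modelPolar κ r α) (modelPolar κ r' β) := by
    intro r r' α β hα hα' hβ hβ'
    rw [KCone.dist_mk, hc α hα hα' β hβ hβ', coneLaw_abs, modelDist_modelPolar]
  have i0 : (0 : ℝ) ∈ Set.Icc 0 θ := ⟨le_rfl, θ0⟩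
  have iθ : θ ∈ Set.Icc 0 θ := ⟨θ0, le_rfl⟩
  have hself : ∀ v ∈ modelCarrier κ, modelDist κ v v = 0 := fun v hv =>
    dist_self (show ModelPlane κ from ⟨v, hv⟩)
  refine ⟨fun s => KCone.mk (ρ s) (c (φ s)), coneLaw κ t₁ t₂ θ, l0.le, ?_, ?_, ?_⟩
  · obtain ⟨a, b, e⟩ := h 0 ⟨le_rfl, l0.le⟩
    apply dist_eq_zero.1
    rw [hdist _ _ _ _ a b i0 (fun _ => Or.inl rfl), e, modelSeg_zero hpos.ne']
    exact hself _ (modelPolar_mem _ _ _)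
  · obtain ⟨a, b, e⟩ := h _ ⟨l0.le, le_rfl⟩
    apply dist_eq_zero.1
    rw [hdist _ _ _ _ a b iθ (fun h => Or.inr h), e, modelSeg_length hpos.ne']
    exact hself _ (modelPolar_mem _ _ _)
  · intro s hs s' hs'
    obtain ⟨a, b, e⟩ := h s hs
    obtain ⟨a', b', e'⟩ := h s' hs'
    rw [hdist _ _ _ _ a b a' b', e, e']
    have := modelDist_modelSeg (modelPolar_mem κ t₁ 0) (modelPolar_mem κ t₂ θ) (by rwa [d])
      (by rwa [d]) (s := s) (s' := s') (by rwa [d]) (by rwa [d])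
    rwa [d] at this

theorem KCone.exists_isGeodesic {κ : ℝ} {Y : Type u} [MetricSpace Y]
    (hY : ∀ y y' : Y, dist y y' < π → ∃ (c : ℝ → Y) (l : ℝ), IsGeodesic c l y y')
    (x x' : KCone κ Y) (hD : 0 < κ → dist x x' < π / √κ) :
    ∃ (c : ℝ → KCone κ Y) (l : ℝ), IsGeodesic c l x x' := by
  rcases (dist_nonneg (x := x) (y := x')).eq_or_lt with h0 | h0
  · refine ⟨fun _ => x, 0, le_rfl, rfl, dist_eq_zero.1 h0.symm, fun t ht t' ht' => ?_⟩
    rw [le_antisymm ht.2 ht.1, le_antisymm ht'.2 ht'.1]; simp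
  obtain ⟨t₁, y₁, rfl⟩ := x.exists_mk
  obtain ⟨t₂, y₂, rfl⟩ := x'.exists_mk
  rw [KCone.dist_mk] at h0 hD
  rcases (tdist_le_pi y₁ y₂).lt_or_eq with hπ | hπ
  · obtain ⟨c, l, hc⟩ := hY y₁ y₂ ((tdist_eq_of_lt hπ).trans_lt hπ)
    have hl : l = tdist y₁ y₂ := hc.length_eq.trans (tdist_eq_of_lt hπ)
    have := KCone.exists_isGeodesic_of_lift t₁ t₂ (tdist_nonneg y₁ y₂) (tdist_le_pi _ _)
      c (fun φ hφ _ φ' hφ' _ => ?_) h0 hD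
    · rwa [hc.2.1, ← hl, hc.2.2.1] at this
    · rw [← hl] at hφ hφ' hπ
      have e := hc.2.2.2 φ hφ φ' hφ'
      rw [← e]
      refine tdist_eq_dist ?_
      rw [e]
      exact (abs_le.2 ⟨by linarith [hφ.1, hφ'.2], by linarith [hφ.2, hφ'.1]⟩).trans hπ.le
  · classical
    have := KCone.exists_isGeodesic_of_lift t₁ t₂ (tdist_nonneg y₁ y₂) (tdist_le_pi _ _)
      -- Only the values at `0` and `π` matter: the geodesic runs along two rays through the apex.
      (fun φ => if φ = 0 then y₁ else y₂) (fun φ _ h φ' _ h' => ?_) h0 hD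
    · rwa [hπ, if_pos rfl, if_neg pi_ne_zero] at this
    · rcases h hπ with rfl | rfl <;> rcases h' hπ with rfl | rfl <;>
        simp [tdist_self, pi_ne_zero, hπ, abs_of_pos pi_pos, tdist_comm y₂ y₁]

/-! ### From the cone to its base -/

/-- By the sine relations, this equation characterises the parameter at which a segment between
points of equal radius has angle `φ`. The difference of the two sides changes sign on `[0, l]`. -/
theorem exists_sn_mul_sin_eq {κ l θ φ : ℝ} (l0 : 0 ≤ l) (hD : 0 < κ → l < π / √κ)
    (hφ : φ ∈ Set.Icc 0 θ) (hθ : θ ≤ π) :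
    ∃ s ∈ Set.Icc 0 l, sn κ s * sin (θ - φ) = sn κ (l - s) * sin φ := by
  have hcont : ContinuousOn (fun s => sn κ s * sin (θ - φ) - sn κ (l - s) * sin φ)
      (Set.Icc 0 l) := by
    have := continuous_sn κ
    fun_prop
  have h1 := sin_nonneg_of_nonneg_of_le_pi hφ.1 (hφ.2.trans hθ)
  have h2 := sin_nonneg_of_nonneg_of_le_pi (sub_nonneg.2 hφ.2) (by linarith [hφ.1])
  have h3 := sn_nonneg l0 (fun hk => (hD hk).le)
  obtain ⟨s, hs, e⟩ := intermediate_value_Icc l0 hcont (show (0 : ℝ) ∈ Set.Icc _ _ by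
    simp only [sn_zero, sub_zero, sub_self, zero_mul, zero_sub]
    exact ⟨neg_nonpos.2 (mul_nonneg h3 h1), mul_nonneg h3 h2⟩)
  exact ⟨s, hs, sub_eq_zero.1 e⟩

/-- A radius `t` for which the triangles on the sphere of radius `t` in the cone have perimeter
less than `2 * (π / √κ)`. -/
theorem exists_small_radius (κ : ℝ) :
    ∃ t ∈ coneRadii κ, 0 < t ∧ (0 < κ → 6 * t < 2 * (π / √κ)) := by
  by_cases h : 0 < κ
  · have h0 : 0 < π / √κ := div_pos pi_pos (sqrt_pos.2 h)
    exact ⟨π / √κ / 4, ⟨by positivity, fun _ => by linarith⟩, by positivity, fun _ => by linarith⟩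
  · exact ⟨1, ⟨zero_le_one, fun h' => absurd h' h⟩, one_pos, fun h' => absurd h' h⟩

theorem angle_eq_of_sin_mul_eq {θ φ φ' : ℝ} (hφ : φ ∈ Set.Icc 0 θ) (hφ' : φ' ∈ Set.Icc 0 θ)
    (θ0 : 0 < θ) (θπ : θ < π) (h : sin φ' * sin (θ - φ) = sin φ * sin (θ - φ')) : φ' = φ := by
  have e : sin θ * sin (φ' - φ) = 0 := by
    rw [sin_sub] at h ⊢
    rw [sin_sub] at h
    linear_combination h
  have := (mul_eq_zero.1 e).resolve_left (sin_pos_of_pos_of_lt_pi θ0 θπ).ne'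
  have := (sin_eq_zero_iff_of_lt_of_lt (by linarith [hφ.2, hφ'.1]) (by linarith [hφ.1, hφ'.2])).1
    this
  linarith

/-- A point on a geodesic between two points of equal radius has the angle `φ` at the apex,
as soon as its distances to the endpoints are in the right proportion. -/
theorem angle_eq_of_collinear {κ t ρ φ φ' θ s : ℝ} (ht : t ∈ coneRadii κ) (t0 : 0 < t)
    (hφ : φ ∈ Set.Icc 0 θ) (hφ' : φ' ∈ Set.Icc 0 θ) (θ0 : 0 < θ) (θπ : θ < π)
    (l0 : 0 < coneLaw κ t t θ) (hD : 0 < κ → coneLaw κ t t θ < π / √κ)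
    (h1 : coneLaw κ t ρ φ' = s) (h2 : coneLaw κ ρ t (θ - φ') = coneLaw κ t t θ - s)
    (hs : s ∈ Set.Icc 0 (coneLaw κ t t θ))
    (h : sn κ s * sin (θ - φ) = sn κ (coneLaw κ t t θ - s) * sin φ) :
    φ' = φ ∧ sn κ ρ ≠ 0 := by
  have hc : coneLaw κ t ρ φ' + coneLaw κ ρ t (θ - φ') = coneLaw κ t t (φ' + (θ - φ')) := by
    rw [h1, h2, add_sub_cancel, add_sub_cancel]
  have i1 := collinear_sin hc
  have i2 := collinear_sin_right hc
  rw [add_sub_cancel, h1] at i1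
  rw [add_sub_cancel, h2] at i2
  have st := sn_pos_of_mem ht t0
  have sl := sn_pos l0 hD
  have sθ := sin_pos_of_pos_of_lt_pi θ0 θπ
  -- Otherwise the sine relations would make both `sn κ s` and `sn κ (l - s)` vanish.
  have hρ : sn κ ρ ≠ 0 := by
    intro h0
    rw [h0] at i1 i2
    have z1 : sn κ s * (sn κ t * sin θ) = 0 := by linarith
    have z2 : sn κ (coneLaw κ t t θ - s) * (sn κ t * sin θ) = 0 := by linarith
    have z1 := (mul_eq_zero.1 z1).resolve_right (mul_pos st sθ).ne'
    have z2 := (mul_eq_zero.1 z2).resolve_right (mul_pos st sθ).ne'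
    rcases hs.1.eq_or_lt with h' | h'
    · rw [← h', sub_zero] at z2
      exact sl.ne' z2
    · exact (sn_pos h' (fun hk => hs.2.trans_lt (hD hk))).ne' z1
  refine ⟨angle_eq_of_sin_mul_eq hφ hφ' θ0 θπ ?_, hρ⟩
  apply mul_left_cancel₀ (mul_ne_zero sl.ne' hρ)
  linear_combination sin (θ - φ) * i1 - sin φ * i2 + sn κ t * sin θ * h

theorem coneLaw_self_pos {κ t θ : ℝ} (ht : t ∈ coneRadii κ) (t0 : 0 < t) (θ0 : 0 < θ)
    (θπ : θ ≤ π) : 0 < coneLaw κ t t θ := by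
  refine (coneLaw_nonneg ht.1 ht.1 θ).lt_of_ne fun h => ?_
  have := angle_le_of_coneLaw_le ht ht t0 t0 θπ le_rfl (h.symm.trans coneLaw_self.symm).le
  linarith

/-- A cone geodesic between the points of small radius `t` over `y` and `y'` avoids the apex, since
the angle is less than `π`. Angles add along it, so its directions, reparametrised by the angle from
`y`, form a geodesic; every angle is attained by `exists_sn_mul_sin_eq`. -/
theorem exists_isGeodesic_of_cone {κ : ℝ} {Y : Type u} [MetricSpace Y]
    (hg : ∀ x y : KCone κ Y, (0 < κ → dist x y < π / √κ) →
      ∃ (c : ℝ → KCone κ Y) (l : ℝ), IsGeodesic c l x y)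
    (y y' : Y) (hπ : dist y y' < π) : ∃ (c : ℝ → Y) (l : ℝ), IsGeodesic c l y y' := by
  rcases (dist_nonneg (x := y) (y := y')).eq_or_lt with h0 | h0
  · refine ⟨fun _ => y, 0, le_rfl, rfl, dist_eq_zero.1 h0.symm, fun t ht t' ht' => ?_⟩
    rw [le_antisymm ht.2 ht.1, le_antisymm ht'.2 ht'.1]; simp
  rw [← tdist_eq_dist hπ.le] at h0 hπ
  obtain ⟨t, ht, t0, ht6⟩ := exists_small_radius κ
  have l0 := coneLaw_self_pos ht t0 h0 hπ.le
  have hD : 0 < κ → coneLaw κ t t (tdist y y') < π / √κ := fun hk => by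
    linarith [coneLaw_le_add ht ht h0.le hπ.le, ht6 hk]
  obtain ⟨γ, l, hγ⟩ := hg (KCone.mk ⟨t, ht⟩ y) (KCone.mk ⟨t, ht⟩ y') hD
  have hl := hγ.length_eq
  rw [KCone.dist_mk] at hl
  change l = coneLaw κ t t (tdist y y') at hl
  rw [← hl] at l0 hD
  choose ρ z hz using fun s => (γ s).exists_mk
  have d1 : ∀ s ∈ Set.Icc 0 l, coneLaw κ t (ρ s) (tdist y (z s)) = s := fun s hs => by
    have := hγ.dist_left hs
    rwa [hz, KCone.dist_mk] at this
  have d2 : ∀ s ∈ Set.Icc 0 l, coneLaw κ (ρ s) t (tdist (z s) y') = l - s := fun s hs => by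
    have := hγ.dist_right hs
    rwa [hz, KCone.dist_mk] at this
  have pρ : ∀ s ∈ Set.Icc 0 l, 0 < (ρ s : ℝ) := fun s hs => by
    refine (ρ s).2.1.lt_of_ne fun h => ?_
    have a := d1 s hs
    have b := d2 s hs
    rw [← h, coneLaw_zero_right_eq ht] at a
    rw [← h, coneLaw_zero_left_eq ht] at b
    have := pi_le_of_coneLaw_eq_add ht ht t0 t0 h0.le (by rw [← hl]; linarith)
    linarith
  have add : ∀ s ∈ Set.Icc 0 l, tdist y (z s) + tdist (z s) y' = tdist y y' := fun s hs =>
    angle_add_of_collinear ht (ρ s).2 ht t0 (pρ s hs) t0 (tdist_nonneg _ _) (tdist_le_pi _ _)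
      (tdist_nonneg _ _) (tdist_le_pi _ _) h0.le hπ.le (tdist_triangle _ _ _)
      (by rw [d1 s hs, d2 s hs, ← hl]; ring)
  have icc : ∀ s ∈ Set.Icc 0 l, tdist y (z s) ∈ Set.Icc 0 (tdist y y') := fun s hs =>
    ⟨tdist_nonneg _ _, by linarith [add s hs, tdist_nonneg (z s) y']⟩
  have mono : ∀ s ∈ Set.Icc 0 l, ∀ s' ∈ Set.Icc 0 l, s ≤ s' →
      tdist (z s) (z s') = tdist y (z s') - tdist y (z s) := by
    intro s hs s' hs' hle
    have e := hγ.2.2.2 s hs s' hs'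
    rw [hz, hz, KCone.dist_mk, abs_sub_comm, abs_of_nonneg (by linarith)] at e
    have := angle_add_of_collinear ht (ρ s).2 (ρ s').2 t0 (pρ s hs) (pρ s' hs')
      (tdist_nonneg y (z s)) (tdist_le_pi _ _) (tdist_nonneg (z s) (z s')) (tdist_le_pi _ _) (tdist_nonneg y (z s'))
      (tdist_le_pi _ _) (tdist_triangle _ _ _) (by rw [d1 s hs, d1 s' hs', e]; ring)
    linarith
  have key : ∀ φ, ∃ s, φ ∈ Set.Icc 0 (tdist y y') → s ∈ Set.Icc 0 l ∧ tdist y (z s) = φ := by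
    intro φ
    by_cases hφ : φ ∈ Set.Icc 0 (tdist y y')
    · obtain ⟨s, hs, e⟩ := exists_sn_mul_sin_eq l0.le hD hφ hπ.le
      refine ⟨s, fun _ => ⟨hs, ?_⟩⟩
      subst hl
      exact (angle_eq_of_collinear ht t0 hφ (icc s hs) h0 hπ l0 hD (d1 s hs)
        (by rw [← d2 s hs, ← add s hs, add_sub_cancel_left]) hs e).1
    · exact ⟨0, fun h => absurd h hφ⟩
  choose σ hσ using key
  refine ⟨fun φ => z (σ φ), tdist y y', h0.le, ?_, ?_, ?_⟩
  · exact (eq_of_tdist_eq_zero (hσ 0 ⟨le_rfl, h0.le⟩).2).symm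
  · obtain ⟨a, b⟩ := hσ _ ⟨h0.le, le_rfl⟩
    exact eq_of_tdist_eq_zero (by linarith [add _ a])
  · intro φ hφ φ' hφ'
    obtain ⟨a, b⟩ := hσ φ hφ
    obtain ⟨a', b'⟩ := hσ φ' hφ'
    have e : tdist (z (σ φ)) (z (σ φ')) = |φ - φ'| := by
      have n := tdist_nonneg (z (σ φ)) (z (σ φ'))
      rcases le_total (σ φ) (σ φ') with h | h
      · have m := mono _ a _ a' h
        rw [m, b, b'] at n
        rw [m, b, b', abs_sub_comm, abs_of_nonneg n]
      · have m := mono _ a' _ a h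
        rw [tdist_comm, m, b, b'] at n
        rw [tdist_comm, m, b, b', abs_of_nonneg n]
    have : tdist (z (σ φ)) (z (σ φ')) < π := by
      rw [e]
      exact (abs_le.2 ⟨by linarith [hφ.1, hφ'.2], by linarith [hφ.2, hφ'.1]⟩).trans_lt hπ
    rw [tdist_eq_of_lt this, e]

/-- Put `w`, `u`, `v` at a common small radius `t`, so that the perimeter is at most `6 * t`, and
`m` at the radius where the planar segment has angle `dist u m`. Then `m` lies between `u` and `v`
in the cone, and the cone inequality becomes the spherical one after removing positive factors. -/
theorem StewartIneq.of_cone {κ : ℝ} {Y : Type u} [MetricSpace Y]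
    (hC : StewartIneq κ (KCone κ Y)) : StewartIneq 1 Y := by
  intro w u v m h hper
  have hper := hper one_pos
  rw [sqrt_one, div_one] at hper
  simp only [sn_one, md_one]
  have n1 := dist_nonneg (x := u) (y := m)
  have n2 := dist_nonneg (x := m) (y := v)
  have T1 := dist_triangle u w v
  have T2 := dist_triangle w v u
  have T3 := dist_triangle w u v
  have hm := dist_le_half (w := w) h
  rw [dist_comm u w] at T1
  rw [dist_comm v u] at T2
  rcases (dist_nonneg (x := u) (y := v)).eq_or_lt with h0 | h0
  · rw [show dist u m = 0 by linarith, show dist m v = 0 by linarith, ← h0]; simp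
  have hπ : dist u v < π := by linarith
  obtain ⟨t, ht, t0, ht6⟩ := exists_small_radius κ
  have l0 := coneLaw_self_pos ht t0 h0 hπ.le
  have hle : ∀ x, 0 ≤ x → x ≤ π → coneLaw κ t t x ≤ 2 * t := fun x hx hx' => by
    linarith [coneLaw_le_add ht ht hx hx']
  have hD : 0 < κ → coneLaw κ t t (dist u v) < π / √κ := fun hk => by
    linarith [hle _ h0.le hπ.le, ht6 hk]
  have hφ : dist u m ∈ Set.Icc 0 (dist u v) := ⟨n1, by linarith⟩
  obtain ⟨s, hs, hseq⟩ := exists_sn_mul_sin_eq l0.le hD hφ hπ.le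
  obtain ⟨ρ, hρ, φ', hφ', -, e⟩ := exists_modelPolar_eq_modelSeg ht ht h0.le hπ.le l0 hD hs
  have d : modelDist κ (modelPolar κ t 0) (modelPolar κ t (dist u v)) = coneLaw κ t t (dist u v) := by
    rw [modelDist_modelPolar, zero_sub, coneLaw_neg]
  have hpos := sn_pos l0 hD
  have seg : ∀ a ∈ Set.Icc 0 (coneLaw κ t t (dist u v)),
      ∀ b ∈ Set.Icc 0 (coneLaw κ t t (dist u v)), _ := fun a ha b hb =>
    modelDist_modelSeg (modelPolar_mem κ t 0) (modelPolar_mem κ t (dist u v)) (by rwa [d])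
      (by rwa [d]) (s := a) (s' := b) (by rwa [d]) (by rwa [d])
  have c1 := seg 0 ⟨le_rfl, l0.le⟩ s hs
  have c2 := seg s hs _ ⟨l0.le, le_rfl⟩
  rw [d, ← e, modelSeg_zero hpos.ne', modelDist_modelPolar, zero_sub, zero_sub, abs_neg,
    coneLaw_neg, abs_of_nonneg hs.1] at c1
  rw [d, ← e, modelSeg_length hpos.ne', modelDist_modelPolar, abs_sub_comm,
    abs_of_nonneg (sub_nonneg.2 hs.2), ← neg_sub, coneLaw_neg] at c2
  obtain ⟨rfl, hρ0⟩ := angle_eq_of_collinear ht t0 hφ hφ' h0 hπ l0 hD c1 c2 hs hseq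
  rw [show dist u v - dist u m = dist m v by linarith] at c2 hseq
  have td : ∀ a b : Y, dist a b ≤ π → dist a b = tdist a b := fun a b h => (tdist_eq_dist h).symm
  have e0 := td u v hπ.le
  have e1 := td u m (by linarith)
  have e2 := td m v (by linarith)
  have e3 := td w u (by linarith)
  have e4 := td w v (by linarith)
  have e5 := td w m (by linarith)
  have hcol : coneLaw κ t ρ (dist u m) + coneLaw κ ρ t (dist m v) = coneLaw κ t t (dist u v) := by
    rw [c1, c2]; ring
  have hcol' := hcol
  rw [← h] at hcol'
  have i1 := collinear_sin hcol'
  have i2 := collinear_sin_right hcol'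
  rw [h] at i1 i2
  have k := hC (KCone.mk ⟨t, ht⟩ w) (KCone.mk ⟨t, ht⟩ u) (KCone.mk ⟨t, ht⟩ v) (KCone.mk ⟨ρ, hρ⟩ m)
  have rad := cone_radial ht hρ ht u v m (by rwa [← e0, ← e1, ← e2])
  simp only [KCone.dist_mk, ← e0, ← e1, ← e2, ← e3, ← e4, ← e5] at k rad
  have k := k hcol (fun hk => by
    linarith [ht6 hk, hle _ h0.le hπ.le, hle (dist w u) dist_nonneg (by linarith),
      hle (dist w v) dist_nonneg (by linarith)])
  have def_eq := stewart_defect (κ := κ) (a := dist w u) (b := dist w v) (c := dist w m)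
    ht.1 ht.1 ht.1 hρ.1 hcol rad
  have st := sn_pos_of_mem ht t0
  have sρ : 0 < sn κ ρ := (sn_nonneg_of_mem hρ).lt_of_ne' hρ0
  have sθ := sin_pos_of_pos_of_lt_pi h0 hπ
  have k2 : 0 ≤ sn κ (coneLaw κ t t (dist u v)) * sn κ ρ * cos (dist w m)
      - (sn κ (coneLaw κ ρ t (dist m v)) * sn κ t * cos (dist w u)
        + sn κ (coneLaw κ t ρ (dist u m)) * sn κ t * cos (dist w v)) := by
    refine nonneg_of_mul_nonneg_right ?_ st
    rw [← def_eq]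
    linarith
  have k3 : 0 ≤ sin (dist u v) * cos (dist w m)
      - (sin (dist m v) * cos (dist w u) + sin (dist u m) * cos (dist w v)) := by
    refine nonneg_of_mul_nonneg_right ?_ (mul_pos hpos sρ)
    refine (mul_nonneg sθ.le k2).trans_eq ?_
    linear_combination cos (dist w u) * i2 + cos (dist w v) * i1
  have s1 := sin_sub (dist u v) (dist u m)
  rw [show dist u v - dist u m = dist m v by linarith] at s1
  linarith

/-- Berestovskii's theorem. -/
theorem mainTheorem5 (κ : ℝ) (Y : Type u) [MetricSpace Y] :
    IsCAT κ (KCone κ Y) ↔ IsCAT 1 Y := by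
  constructor
  · intro h
    refine isCAT_of_stewartIneq (fun y y' hd => ?_) (StewartIneq.of_cone h.stewartIneq)
    have := hd one_pos
    rw [sqrt_one, div_one] at this
    exact exists_isGeodesic_of_cone h.1 y y' this
  · intro h
    refine isCAT_of_stewartIneq (fun x x' hd => ?_) (StewartIneq.cone h.stewartIneq)
    refine KCone.exists_isGeodesic (fun y y' hd => h.1 y y' fun _ => ?_) x x' hd
    rwa [sqrt_one, div_one]
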